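/- Let $F=\mathbb F_{101}$. An associative dialgebra over $F$ is an $F$-vector space with bilinear operations $\dashv,\vdash$ satisfying $(a\vdash b)\vdash c=(a\dashv b)\vdash c$, $a\dashv(b\dashv c)=a\dashv(b\vdash c)$, $(a\dashv b)\dashv c=a\dashv(b\dashv c)$, $(a\vdash b)\vdash c=a\vdash(b\vdash c)$ and $(a\vdash b)\dashv c=a\vdash(b\dashv c)$. The quasi-Jordan product is $ab=a\dashv b+b\vdash a$ (omitting the customary factor $\tfrac12$); it satisfies right commutativity $a(bc)=a(cb)$. Let $FRC_n$ be the space of multilinear elements of degree $n$ in $x_1,\dots,x_n$ in the free right-commutative $F$-algebra on $x_1,x_2,\dots$; an identity for the quasi-Jordan product is an element of this free algebra that vanishes under every substitution into every associative dialgebra over $F$. The consequences of a set of identities are the elements of the T-ideal it generates (the smallest two-sided ideal of the free right-commutative algebra that contains the set and is mapped into itself by all endomorphisms). Let $$J=(a(bc))d+(a(bd))c+(a(cd))b-(ab)(cd)-(ac)(bd)-(ad)(bc),$$ $$K=((ab)d)c+((ac)d)b-(a(bc))d-(a(bd))c-(a(cd))b+a((bc)d)$$ with $(a,b,c,d)=(x_1,x_2,x_3,x_4)$.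 The liftings to degree $n+1$ of $I(x_1,\dots,x_n)\in FRC_n$ are the $n+2$ elements $I(x_1,\dots,x_ix_{n+1},\dots,x_n)$ for $1\le i\le n$, $I\,x_{n+1}$ and $x_{n+1}I$; liftings to higher degrees are obtained by iteration. Let $FD_n$ be the multilinear component of degree $n$ in the free associative dialgebra on $x_1,x_2,\dots$, with basis the normal forms $a_1\cdots a_{k-1}\widehat{a_k}a_{k+1}\cdots a_n$, where $1\le k\le n$ and $a_1\cdots a_n$ is a permutation of $x_1,\dots,x_n$. The expansion matrix $[E_n]$ is the matrix, with respect to the bases of monomials, of the linear map $E_n\colon FRC_n\to FD_n$ defined by $E(x_i)=x_i$ and $E(uv)=E(u)\dashv E(v)+E(v)\vdash E(u)$. **Proposition.** Over $F=\mathbb F_{101}$: 1. Every identity in $FRC_6$ for the quasi-Jordan product is a consequence of the multilinear identities for the quasi-Jordan product of degree $\le 5$. 2. The elements of $FRC_6$ that are consequences of the multilinear identities of degree $\le 5$ form a space of dimension $3690$. 3. The lifted identities in degree $6$, that is, the span of all permutations of the variables $x_1,\dots,x_6$ in the liftings of $J$ and $K$ to degree $6$, have dimension $3690$. 4. The expansion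 matrix $[E_6]$ has $4320$ rows and $5670$ columns, and its kernel has dimension $3690$. -/

import Mathlib

namespace QuasiJordan

universe u v

/-! ### Associative dialgebras and the quasi-Jordan product -/

/-- An associative dialgebra over `R`: `left a b` is `a ⊣ b` and `right a b` is `a ⊢ b`. -/
class AssocDialgebra (R : Type u) (D : Type v) [CommRing R] [AddCommGroup D] [Module R D] where
  left : D →ₗ[R] D →ₗ[R] D
  right : D →ₗ[R] D →ₗ[R] D
  right_right_bar : ∀ a b c : D, right (right a b) c = right (left a b) c
  left_left_bar : ∀ a b c : D, left a (left b c) = left a (right b c)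
  left_assoc : ∀ a b c : D, left (left a b) c = left a (left b c)
  right_assoc : ∀ a b c : D, right (right a b) c = right a (right b c)
  inner_assoc : ∀ a b c : D, left (right a b) c = right a (left b c)

/-- The quasi-Jordan product `a b = a ⊣ b + b ⊢ a` (the customary factor `1/2` is omitted). -/
def qjMul (R : Type u) (D : Type v) [CommRing R] [AddCommGroup D] [Module R D]
    [AssocDialgebra R D] : D →ₗ[R] D →ₗ[R] D :=
  AssocDialgebra.left + (AssocDialgebra.right : D →ₗ[R] D →ₗ[R] D).flip

theorem qjMul_apply (R : Type u) {D : Type v} [CommRing R] [AddCommGroup D] [Module R D]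
    [AssocDialgebra R D] (a b : D) :
    qjMul R D a b = AssocDialgebra.left (R := R) a b + AssocDialgebra.right (R := R) b a := rfl

theorem qjMul_right_comm (R : Type u) {D : Type v} [CommRing R] [AddCommGroup D] [Module R D]
    [AssocDialgebra R D] (a b c : D) :
    qjMul R D a (qjMul R D b c) = qjMul R D a (qjMul R D c b) := by
  simp only [qjMul_apply, map_add, AssocDialgebra.left_left_bar,
    AssocDialgebra.right_right_bar]
  abel

/-! ### The free right-commutative algebra -/

/-- The instances of right commutativity `a (b c) = a (c b)` among nonassociative words. -/
inductive RCRel (X : Type u) : FreeMagma X → FreeMagma X → Prop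
  | rc (a b c : FreeMagma X) : RCRel X (a * (b * c)) (a * (c * b))

/-- Right-commutative monomials on `X`: nonassociative words modulo the congruence
generated by right commutativity. -/
abbrev RCMagma (X : Type u) : Type u := (conGen (RCRel X)).Quotient

/-- The value of a nonassociative word under a binary operation and an assignment of letters. -/
def wordEval {X : Type u} {A : Type v} (op : A → A → A) (x : X → A) : FreeMagma X → A
  | .of i => x i
  | .mul s t => op (wordEval op x s) (wordEval op x t)

theorem wordEval_congr {X : Type u} {A : Type v} (op : A → A → A)
    (hop : ∀ a b c, op a (op b c) = op a (op c b)) (x : X → A) (s t : FreeMagma X)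
    (h : conGen (RCRel X) s t) : wordEval op x s = wordEval op x t := by
  let c : Con (FreeMagma X) :=
    { r := fun s t => wordEval op x s = wordEval op x t
      iseqv := ⟨fun _ => rfl, fun h => h.symm, fun h k => h.trans k⟩
      mul' := fun {a b c d} h k => by
        change op (wordEval op x a) (wordEval op x c) = op (wordEval op x b) (wordEval op x d)
        rw [show wordEval op x a = wordEval op x b from h,
          show wordEval op x c = wordEval op x d from k] }
  have hle : conGen (RCRel X) ≤ c := by
    rw [Con.conGen_le]
    rintro _ _ ⟨a, b, d⟩
    exact hop _ _ _
  exact hle h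

/-- The value of a right-commutative monomial under a right-commutative operation. -/
def monEval {X : Type u} {A : Type v} (op : A → A → A)
    (hop : ∀ a b c, op a (op b c) = op a (op c b)) (x : X → A) (w : RCMagma X) : A :=
  Con.liftOn w (wordEval op x) (wordEval_congr op hop x)

/-- The multiset of letters of a right-commutative monomial. -/
def content {X : Type u} : RCMagma X → Multiset X :=
  monEval (fun s t => s + t) (fun a b c => by rw [add_comm b c]) (fun i => {i})

/-- The free right-commutative algebra on `X`: linear combinations of right-commutative
monomials, with the bilinear extension of the product of monomials. -/
abbrev FreeRC (R : Type u) (X : Type v) [CommRing R] : Type (max u v) :=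
  MonoidAlgebra R (RCMagma X)

/-- Evaluation of a right-commutative polynomial in a module with a right-commutative bilinear
product, at a given assignment of the variables. -/
noncomputable def eval {R : Type u} {X A : Type*} [CommRing R] [AddCommGroup A] [Module R A]
    (μ : A →ₗ[R] A →ₗ[R] A) (hμ : ∀ a b c, μ a (μ b c) = μ a (μ c b)) (x : X → A) :
    FreeRC R X →ₗ[R] A :=
  Finsupp.linearCombination R (monEval (fun a b => μ a b) hμ x) ∘ₗ
    (MonoidAlgebra.coeffLinearEquiv R).toLinearMap

/-- `f` is an identity for the quasi-Jordan product: it vanishes under every assignment of its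
variables in every associative dialgebra over `R`. -/
def IsIdentity {R : Type u} {X : Type*} [CommRing R] (f : FreeRC R X) : Prop :=
  ∀ (D : Type u) [AddCommGroup D] [Module R D] [AssocDialgebra R D] (x : X → D),
    eval (qjMul R D) (qjMul_right_comm R) x f = 0

/-- The generator `x_i` of the free right-commutative algebra on `x_0, x_1, x_2, …`. -/
noncomputable def gen (R : Type u) [CommRing R] (i : ℕ) : FreeRC R ℕ :=
  MonoidAlgebra.single ((FreeMagma.of i : FreeMagma ℕ) : RCMagma ℕ) 1

/-- `FRC R n`: the right-commutative polynomials that are multilinear of degree `n` in the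
variables `x_0, …, x_{n-1}`. -/
noncomputable def FRC (R : Type u) [CommRing R] (n : ℕ) : Submodule R (FreeRC R ℕ) :=
  MonoidAlgebra.supported R R {w | content w = Multiset.range n}

/-! ### Consequences of identities -/

/-- The T-ideal generated by `S`: the smallest two-sided ideal that contains `S` and is sent to
itself by all algebra endomorphisms. -/
noncomputable def tIdeal {R : Type u} [CommRing R] (S : Set (FreeRC R ℕ)) : Submodule R (FreeRC R ℕ) :=
  sInf {I | S ⊆ I ∧ (∀ a ∈ I, ∀ b, a * b ∈ I ∧ b * a ∈ I) ∧
    ∀ (φ : FreeRC R ℕ →ₙₐ[R] FreeRC R ℕ), ∀ a ∈ I, φ a ∈ I}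

/-- The consequences of the multilinear identities for the quasi-Jordan product
of degree at most `m`. -/
noncomputable def consequences (R : Type u) [CommRing R] (m : ℕ) : Submodule R (FreeRC R ℕ) :=
  tIdeal {f | IsIdentity f ∧ ∃ k ≤ m, f ∈ FRC R k}

theorem freeRC_mul_right_comm {R : Type u} {X : Type v} [CommRing R] (a b c : FreeRC R X) :
    a * (b * c) = a * (c * b) := by
  have key : ∀ s t w : RCMagma X, s * (t * w) = s * (w * t) := by
    intro s t w
    induction s using Con.induction_on
    induction t using Con.induction_on
    induction w using Con.induction_on
    exact (Con.eq _).2 (ConGen.Rel.of _ _ (RCRel.rc _ _ _))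
  induction a using MonoidAlgebra.induction_linear with
  | zero => simp
  | add f g hf hg => rw [add_mul, add_mul, hf, hg]
  | single s r =>
    induction b using MonoidAlgebra.induction_linear with
    | zero => simp
    | add f g hf hg => rw [add_mul, mul_add, mul_add, mul_add, hf, hg]
    | single t r' =>
      induction c using MonoidAlgebra.induction_linear with
      | zero => simp
      | add f g hf hg => rw [add_mul, mul_add, mul_add, mul_add, hf, hg]
      | single w r'' =>
        simp only [MonoidAlgebra.single_mul_single, key s t w, mul_comm r' r'']

/-- Substitution of right-commutative polynomials for the variables. -/
noncomputable def subst {R : Type u} [CommRing R] (x : ℕ → FreeRC R ℕ) :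
    FreeRC R ℕ →ₗ[R] FreeRC R ℕ :=
  eval (LinearMap.mul R (FreeRC R ℕ)) freeRC_mul_right_comm x

/-- The `n + 2` liftings to degree `n + 1` of a multilinear polynomial `f` in
`x_0, …, x_{n-1}`: replace `x_i` by `x_i x_n` for some `i < n`, or multiply by `x_n` on the right
or on the left. -/
def liftings {R : Type u} [CommRing R] (n : ℕ) (f : FreeRC R ℕ) : Set (FreeRC R ℕ) :=
  {g | (∃ i < n, g = subst (Function.update (gen R) i (gen R i * gen R n)) f) ∨
    g = f * gen R n ∨ g = gen R n * f}

/-- The multilinear form of the quasi-Jordan identity. -/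
noncomputable def J (R : Type u) [CommRing R] : FreeRC R ℕ :=
  let a := gen R 0
  let b := gen R 1
  let c := gen R 2
  let d := gen R 3
  (a * (b * c)) * d + (a * (b * d)) * c + (a * (c * d)) * b
    - (a * b) * (c * d) - (a * c) * (b * d) - (a * d) * (b * c)

/-- The multilinear form of the associator-derivation identity. -/
noncomputable def K (R : Type u) [CommRing R] : FreeRC R ℕ :=
  let a := gen R 0
  let b := gen R 1
  let c := gen R 2
  let d := gen R 3
  ((a * b) * d) * c + ((a * c) * d) * b
    - (a * (b * c)) * d - (a * (b * d)) * c - (a * (c * d)) * b + a * ((b * c) * d)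

/-- The liftings of `J` and `K` to degree `4 + k`. -/
def liftingsJK (R : Type u) [CommRing R] : ℕ → Set (FreeRC R ℕ)
  | 0 => {J R, K R}
  | k + 1 => {g | ∃ f ∈ liftingsJK R k, g ∈ liftings (4 + k) f}

/-- The span of all permutations (of the variables `x_0, …, x_{3+k}`) of the liftings of
`J` and `K` to degree `4 + k`. -/
noncomputable def liftedIdentities (R : Type u) [CommRing R] (k : ℕ) : Submodule R (FreeRC R ℕ) :=
  Submodule.span R {g | ∃ σ : Equiv.Perm ℕ, (∀ i, 4 + k ≤ i → σ i = i) ∧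
    ∃ f ∈ liftingsJK R k, g = subst (fun i => gen R (σ i)) f}

/-! ### The free associative dialgebra -/

/-- A dialgebra monomial in normal form: a word with one marked letter, the center. -/
@[ext] structure DiWord (X : Type u) : Type u where
  pre : List X
  center : X
  post : List X

namespace DiWord

variable {X : Type u}

/-- The underlying word. -/
def toList (w : DiWord X) : List X := w.pre ++ w.center :: w.post

/-- `v ⊣ w`: concatenation, with the center of `v`. -/
def left (v w : DiWord X) : DiWord X := ⟨v.pre, v.center, v.post ++ w.toList⟩

/-- `v ⊢ w`: concatenation, with the center of `w`. -/
def right (v w : DiWord X) : DiWord X := ⟨v.toList ++ w.pre, w.center, w.post⟩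

end DiWord

/-- The free associative dialgebra on `X`, on its basis of normal forms. -/
abbrev FreeDi (R : Type u) (X : Type v) [CommRing R] : Type (max u v) := DiWord X →₀ R

/-- The bilinear extension of an operation on basis elements. -/
noncomputable def bilinExt (R : Type u) {M : Type v} [CommRing R] (op : M → M → M) :
    (M →₀ R) →ₗ[R] (M →₀ R) →ₗ[R] (M →₀ R) :=
  Finsupp.linearCombination R (fun a => Finsupp.lmapDomain R R (op a))

theorem bilinExt_single (R : Type u) {M : Type v} [CommRing R] (op : M → M → M) (a b : M)
    (r s : R) : bilinExt R op (Finsupp.single a r) (Finsupp.single b s) =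
      Finsupp.single (op a b) (r * s) := by
  simp [bilinExt, Finsupp.mapDomain_single]

theorem bilinExt_assoc (R : Type u) {M : Type v} [CommRing R] (p q p' q' : M → M → M)
    (h : ∀ a b c, p (q a b) c = p' a (q' b c)) (a b c : M →₀ R) :
    bilinExt R p (bilinExt R q a b) c = bilinExt R p' a (bilinExt R q' b c) := by
  induction a using Finsupp.induction_linear with
  | zero => simp
  | add f g hf hg => simp only [map_add, LinearMap.add_apply, hf, hg]
  | single s r =>
    induction b using Finsupp.induction_linear with
    | zero => simp
    | add f g hf hg => simp only [map_add, LinearMap.add_apply, hf, hg]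
    | single t r' =>
      induction c using Finsupp.induction_linear with
      | zero => simp
      | add f g hf hg => simp only [map_add, hf, hg]
      | single w r'' => simp only [bilinExt_single, h, mul_assoc]

noncomputable instance (R : Type u) (X : Type v) [CommRing R] : AssocDialgebra R (FreeDi R X) where
  left := bilinExt R DiWord.left
  right := bilinExt R DiWord.right
  right_right_bar a b c := by
    rw [bilinExt_assoc R _ _ DiWord.right DiWord.right, bilinExt_assoc R _ _ DiWord.right
      DiWord.right] <;> intros <;> simp [DiWord.left, DiWord.right, DiWord.toList]
  left_left_bar a b c := by
    rw [← bilinExt_assoc R DiWord.left DiWord.left, ← bilinExt_assoc R DiWord.left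
      DiWord.left] <;> intros <;> simp [DiWord.left, DiWord.right, DiWord.toList]
  left_assoc a b c := bilinExt_assoc R _ _ _ _
    (by intros; simp [DiWord.left, DiWord.toList]) a b c
  right_assoc a b c := bilinExt_assoc R _ _ _ _
    (by intros; simp [DiWord.right, DiWord.toList]) a b c
  inner_assoc a b c := bilinExt_assoc R _ _ _ _
    (by intros; simp [DiWord.left, DiWord.right, DiWord.toList]) a b c

/-! ### The expansion map and its matrix -/

/-- The expansion map: it sends each variable to itself and the product `u v` to
`E u ⊣ E v + E v ⊢ E u`. -/
noncomputable def expand (R : Type u) [CommRing R] : FreeRC R ℕ →ₗ[R] FreeDi R ℕ :=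
  eval (qjMul R (FreeDi R ℕ)) (qjMul_right_comm R) (fun i => Finsupp.single ⟨[], i, []⟩ 1)

/-- The multilinear right-commutative monomials of degree `n` (a basis of `FRC R n`). -/
def RCMon (n : ℕ) : Type := {w : RCMagma ℕ // content w = Multiset.range n}

/-- The multilinear dialgebra monomials of degree `n`. -/
def DiMon (n : ℕ) : Type := {w : DiWord ℕ // (w.toList : Multiset ℕ) = Multiset.range n}

/-- The matrix of the expansion map in degree `n` with respect to the monomial bases. -/
noncomputable def expansionMatrix (R : Type u) [CommRing R] (n : ℕ) :
    Matrix (DiMon n) (RCMon n) R :=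
  fun i j => expand R (MonoidAlgebra.single j.1 1) i.1

theorem finite_words (s : Multiset ℕ) :
    {t : FreeMagma ℕ | wordEval (fun a b : Multiset ℕ => a + b) (fun i => {i}) t = s}.Finite := by
  have hne : ∀ t : FreeMagma ℕ,
      wordEval (fun a b : Multiset ℕ => a + b) (fun i => {i}) t ≠ 0 := by
    intro t
    induction t with
    | ih1 i => exact Multiset.singleton_ne_zero i
    | ih2 a b ha hb =>
      intro h
      exact ha (add_eq_zero.1 h).1
  induction s using Multiset.strongInductionOn with
  | ih s ih =>
    let W (p : Multiset ℕ) : Set (FreeMagma ℕ) :=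
      {t | wordEval (fun a b : Multiset ℕ => a + b) (fun i => {i}) t = p}
    have h1 : ((s.toFinset : Set ℕ).image FreeMagma.of).Finite := s.toFinset.finite_toSet.image _
    have h2 : (⋃ p ∈ {p : Multiset ℕ | p < s}, ⋃ q ∈ {q : Multiset ℕ | q < s},
        Set.image2 (fun a b : FreeMagma ℕ => a * b) (W p) (W q)).Finite :=
      (Set.finite_Iio s).biUnion fun p hp => (Set.finite_Iio s).biUnion fun q hq =>
        (ih p hp).image2 _ (ih q hq)
    refine (h1.union h2).subset fun t ht => ?_
    induction t with
    | ih1 i =>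
      left
      have ht' : ({i} : Multiset ℕ) = s := ht
      exact ⟨i, by simp [← ht'], rfl⟩
    | ih2 a b _ _ =>
      right
      have ht' : wordEval (fun a b : Multiset ℕ => a + b) (fun i => {i}) a +
        wordEval (fun a b : Multiset ℕ => a + b) (fun i => {i}) b = s := ht
      simp only [Set.mem_iUnion]
      refine ⟨_, ?_, _, ?_, a, rfl, b, rfl, rfl⟩
      · rw [Set.mem_ofPred_eq, ← ht']
        exact lt_add_of_pos_right _ (pos_iff_ne_zero.2 (hne b))
      · rw [Set.mem_ofPred_eq, ← ht']
        exact lt_add_of_pos_left _ (pos_iff_ne_zero.2 (hne a))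

instance (n : ℕ) : Finite (RCMon n) := by
  have h : {w : RCMagma ℕ | content w = Multiset.range n}.Finite := by
    refine ((finite_words (Multiset.range n)).image
      (fun t => ((t : FreeMagma ℕ) : RCMagma ℕ))).subset ?_
    intro w hw
    induction w using Con.induction_on with
    | H t => exact ⟨t, hw, rfl⟩
  exact h.to_subtype

noncomputable instance (n : ℕ) : Fintype (RCMon n) := Fintype.ofFinite _

end QuasiJordan

/-! All four claims follow from a squeeze. In degree 6 there are inclusions: lifted identities ⊆
consequences ⊆ identities ⊆ kernel of the expansion map. The first holds because `J` and `K` are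
identities of degree 4. The second holds because the identities form a T-ideal. The third holds
because expansion is evaluation in the free dialgebra. The rank and nullity of expansion on `FRC 6`
add up to the number of monomials, which is at most 5670 (`card_RCMon_le`). The rank is at least
1980 (`le_finrank_map_expand`), and the lifted identities have dimension at least 3690
(`le_finrank_liftedIdentities`). Since 1980 + 3690 = 5670, every inequality is an equality and all
the spaces coincide. Thus no upper bound on a rank is computed, and the representatives that bound
the number of monomials need not be shown inequivalent. Both lower bounds use a symmetry. The first
letter of a monomial becomes the center of every term of its expansion, so the spaces split into six
parts that the transpositions (0 c) permute. By `six_mul_finrank_le` it suffices to find dimensions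
615 and 330 in the part of `x_0`. These come from Gaussian elimination modulo 101 in the kernel. The
elimination is not proved correct as an algorithm: its vectors stay in the given subspace
(`PivotTree.All`), and the output is checked to be in echelon form and of the required length. -/

namespace QuasiJordan

universe u v

/-! ### Universal property of the free right-commutative algebra -/

section Evaluation

variable {R : Type u} {X : Type*} {A : Type*} [CommRing R] [AddCommGroup A] [Module R A]

theorem monEval_mul {X : Type u} {A : Type v} (op : A → A → A)
    (hop : ∀ a b c, op a (op b c) = op a (op c b)) (x : X → A) (v w : RCMagma X) :
    monEval op hop x (v * w) = op (monEval op hop x v) (monEval op hop x w) := by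
  induction v using Con.induction_on
  induction w using Con.induction_on
  rfl

theorem eval_single (μ : A →ₗ[R] A →ₗ[R] A) (hμ : ∀ a b c, μ a (μ b c) = μ a (μ c b))
    (x : X → A) (w : RCMagma X) (r : R) :
    eval μ hμ x (MonoidAlgebra.single w r) = r • monEval (fun a b => μ a b) hμ x w := by
  simp [eval]

theorem eval_mul (μ : A →ₗ[R] A →ₗ[R] A) (hμ : ∀ a b c, μ a (μ b c) = μ a (μ c b))
    (x : X → A) (f g : FreeRC R X) :
    eval μ hμ x (f * g) = μ (eval μ hμ x f) (eval μ hμ x g) := by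
  induction f using MonoidAlgebra.induction_linear with
  | zero => simp
  | add f f' hf hf' => simp only [add_mul, map_add, hf, hf', LinearMap.add_apply]
  | single v r =>
    induction g using MonoidAlgebra.induction_linear with
    | zero => simp
    | add g g' hg hg' => simp only [mul_add, map_add, hg, hg']
    | single w s =>
      simp only [MonoidAlgebra.single_mul_single, eval_single, monEval_mul, map_smul,
        LinearMap.smul_apply, smul_smul, mul_comm r s]

theorem eval_gen (μ : A →ₗ[R] A →ₗ[R] A) (hμ : ∀ a b c, μ a (μ b c) = μ a (μ c b))
    (x : ℕ → A) (i : ℕ) : eval μ hμ x (gen R i) = x i := by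
  rw [gen, eval_single, one_smul]
  rfl

/-- The monomial of a nonassociative word. -/
noncomputable def mon (R : Type u) [CommRing R] (t : FreeMagma ℕ) : FreeRC R ℕ :=
  MonoidAlgebra.single (t : RCMagma ℕ) 1

theorem mon_of (i : ℕ) : mon R (FreeMagma.of i) = gen R i := rfl

theorem mon_mul (s t : FreeMagma ℕ) : mon R (s * t) = mon R s * mon R t := by
  simp only [mon, MonoidAlgebra.single_mul_single, mul_one]
  rfl

theorem freeRC_induction {p : FreeRC R ℕ → Prop} (f : FreeRC R ℕ) (zero : p 0)
    (add : ∀ f g, p f → p g → p (f + g)) (smul : ∀ (r : R) t, p (r • mon R t)) : p f := by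
  induction f using MonoidAlgebra.induction_linear with
  | zero => exact zero
  | add f g hf hg => exact add f g hf hg
  | single w r =>
    induction w using Con.induction_on with
    | H t =>
      convert smul r t
      simp [mon]

/-- A linear map that is multiplicative is the evaluation at the images of the generators. -/
theorem eq_eval (μ : A →ₗ[R] A →ₗ[R] A) (hμ : ∀ a b c, μ a (μ b c) = μ a (μ c b))
    (φ : FreeRC R ℕ →ₗ[R] A) (hφ : ∀ f g, φ (f * g) = μ (φ f) (φ g)) (f : FreeRC R ℕ) :
    φ f = eval μ hμ (fun i => φ (gen R i)) f := by
  induction f using freeRC_induction with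
  | zero => simp
  | add f g hf hg => rw [map_add, map_add, hf, hg]
  | smul r t =>
    rw [map_smul, map_smul]
    congr 1
    induction t with
    | ih1 i => exact (eval_gen μ hμ (fun i => φ (gen R i)) i).symm
    | ih2 s t hs ht => rw [mon_mul, hφ, hs, ht, eval_mul]

theorem subst_mul (y : ℕ → FreeRC R ℕ) (f g : FreeRC R ℕ) :
    subst y (f * g) = subst y f * subst y g :=
  eval_mul _ _ _ _ _

theorem subst_gen (y : ℕ → FreeRC R ℕ) (i : ℕ) : subst y (gen R i) = y i :=
  eval_gen _ _ _ _

theorem eval_subst (μ : A →ₗ[R] A →ₗ[R] A) (hμ : ∀ a b c, μ a (μ b c) = μ a (μ c b))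
    (x : ℕ → A) (y : ℕ → FreeRC R ℕ) (f : FreeRC R ℕ) :
    eval μ hμ x (subst y f) = eval μ hμ (fun i => eval μ hμ x (y i)) f := by
  have h := eq_eval μ hμ (eval μ hμ x ∘ₗ subst y)
    (fun f g => by simp only [LinearMap.comp_apply, subst_mul, eval_mul]) f
  simpa only [LinearMap.comp_apply, subst_gen] using h

/-- Substitution as a homomorphism of algebras. -/
noncomputable def substHom (y : ℕ → FreeRC R ℕ) : FreeRC R ℕ →ₙₐ[R] FreeRC R ℕ where
  toFun := subst y
  map_smul' r f := map_smul _ r f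
  map_zero' := map_zero _
  map_add' f g := map_add _ f g
  map_mul' f g := subst_mul y f g

end Evaluation

/-! ### Identities form a T-ideal -/

section Identities

variable {R : Type u} [CommRing R]

/-- An evaluation composed with an endomorphism is again an evaluation, at other elements of the
same dialgebra. -/
theorem isIdentity_map (φ : FreeRC R ℕ →ₙₐ[R] FreeRC R ℕ) {f : FreeRC R ℕ} (hf : IsIdentity f) :
    IsIdentity (φ f) := by
  intro D _ _ _ x
  have h := eq_eval (qjMul R D) (qjMul_right_comm R)
    (eval (qjMul R D) (qjMul_right_comm R) x ∘ₗ (φ : FreeRC R ℕ →ₗ[R] FreeRC R ℕ))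
    (fun f g => by simp [eval_mul]) f
  simp only [LinearMap.comp_apply] at h
  exact h.trans (hf D _)

/-- The subspace of identities for the quasi-Jordan product. -/
def identities (R : Type u) [CommRing R] : Submodule R (FreeRC R ℕ) where
  carrier := {f | IsIdentity f}
  zero_mem' := fun D _ _ _ x => map_zero _
  add_mem' := fun hf hg D _ _ _ x => by rw [map_add, hf, hg, add_zero]
  smul_mem' := fun r f hf D _ _ _ x => by rw [map_smul, hf, smul_zero]

theorem consequences_le_identities (m : ℕ) : consequences R m ≤ identities R := by
  refine sInf_le ⟨fun f hf => hf.1, fun f hf g => ⟨?_, ?_⟩, fun φ f hf => isIdentity_map φ hf⟩ <;>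
  · intro D _ _ _ x
    have := hf D x
    simp [eval_mul, this]

/-- Expansion is one particular evaluation. The converse inclusion is not needed: in degree 6 the
dimension count supplies it. -/
theorem identities_le_ker_expand : identities R ≤ LinearMap.ker (expand R) :=
  fun _ hf => hf _ _

theorem subset_tIdeal (S : Set (FreeRC R ℕ)) : S ⊆ tIdeal S := by
  intro f hf
  simp only [tIdeal, SetLike.mem_coe, Submodule.mem_sInf]
  exact fun I hI => hI.1 hf

theorem tIdeal_mul_mem {S : Set (FreeRC R ℕ)} {f : FreeRC R ℕ} (hf : f ∈ tIdeal S)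
    (g : FreeRC R ℕ) : f * g ∈ tIdeal S ∧ g * f ∈ tIdeal S := by
  simp only [tIdeal, Submodule.mem_sInf] at hf ⊢
  exact ⟨fun I hI => (hI.2.1 f (hf I hI) g).1, fun I hI => (hI.2.1 f (hf I hI) g).2⟩

theorem tIdeal_map_mem {S : Set (FreeRC R ℕ)} {f : FreeRC R ℕ} (hf : f ∈ tIdeal S)
    (φ : FreeRC R ℕ →ₙₐ[R] FreeRC R ℕ) : φ f ∈ tIdeal S := by
  simp only [tIdeal, Submodule.mem_sInf] at hf ⊢
  exact fun I hI => hI.2.2 φ f (hf I hI)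

theorem tIdeal_subst_mem {S : Set (FreeRC R ℕ)} {f : FreeRC R ℕ} (hf : f ∈ tIdeal S)
    (y : ℕ → FreeRC R ℕ) : subst y f ∈ tIdeal S :=
  tIdeal_map_mem hf (substHom y)

theorem tIdeal_liftings_mem {S : Set (FreeRC R ℕ)} {n : ℕ} {f g : FreeRC R ℕ}
    (hf : f ∈ tIdeal S) (hg : g ∈ liftings n f) : g ∈ tIdeal S := by
  rcases hg with ⟨i, -, rfl⟩ | rfl | rfl
  · exact tIdeal_subst_mem hf _
  · exact (tIdeal_mul_mem hf _).1
  · exact (tIdeal_mul_mem hf _).2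

theorem tIdeal_liftingsJK_mem {S : Set (FreeRC R ℕ)} (hJ : J R ∈ tIdeal S) (hK : K R ∈ tIdeal S)
    (k : ℕ) : ∀ f ∈ liftingsJK R k, f ∈ tIdeal S := by
  induction k with
  | zero =>
    rintro f (rfl | rfl)
    exacts [hJ, hK]
  | succ k ih =>
    rintro g ⟨f, hf, hg⟩
    exact tIdeal_liftings_mem (ih f hf) hg

theorem liftedIdentities_le_tIdeal {S : Set (FreeRC R ℕ)} (hJ : J R ∈ tIdeal S)
    (hK : K R ∈ tIdeal S) (k : ℕ) : liftedIdentities R k ≤ tIdeal S := by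
  refine Submodule.span_le.2 ?_
  rintro g ⟨σ, -, f, hf, rfl⟩
  exact tIdeal_subst_mem (tIdeal_liftingsJK_mem hJ hK k f hf) _

theorem isIdentity_J : IsIdentity (J R) := by
  intro D _ _ _ x
  -- The dialgebra axioms, oriented this way, rewrite each product to the form a₁ ⊢ (⋯ ⊢ (a_k ⊣ (⋯ ⊣
  -- a_n))), after which the terms cancel.
  simp only [J, map_add, map_sub, eval_mul, eval_gen, qjMul_apply, LinearMap.add_apply,
    ← AssocDialgebra.left_left_bar, AssocDialgebra.left_assoc, AssocDialgebra.inner_assoc,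
    ← AssocDialgebra.right_right_bar, AssocDialgebra.right_assoc]
  abel

theorem isIdentity_K : IsIdentity (K R) := by
  intro D _ _ _ x
  simp only [K, map_add, map_sub, eval_mul, eval_gen, qjMul_apply, LinearMap.add_apply,
    ← AssocDialgebra.left_left_bar, AssocDialgebra.left_assoc, AssocDialgebra.inner_assoc,
    ← AssocDialgebra.right_right_bar, AssocDialgebra.right_assoc]
  abel

end Identities

/-! ### Multilinear polynomials and renaming of variables -/

section Multilinear

variable {R : Type u} [CommRing R]

theorem content_of (i : ℕ) : content ((FreeMagma.of i : FreeMagma ℕ) : RCMagma ℕ) = {i} := rfl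

theorem FRC_eq_span (n : ℕ) : FRC R n =
    Submodule.span R {f | ∃ t : FreeMagma ℕ, content (t : RCMagma ℕ) = Multiset.range n ∧
      mon R t = f} := by
  rw [FRC, MonoidAlgebra.supported_eq_span_single]
  congr 1
  ext f
  constructor
  · rintro ⟨w, hw, rfl⟩
    induction w using Con.induction_on with
    | H t => exact ⟨t, hw, rfl⟩
  · rintro ⟨t, ht, rfl⟩
    exact ⟨_, ht, rfl⟩

theorem mon_mem_FRC {n : ℕ} {t : FreeMagma ℕ} (ht : content (t : RCMagma ℕ) = Multiset.range n) :
    mon R t ∈ FRC R n := by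
  rw [FRC_eq_span]
  exact Submodule.subset_span ⟨t, ht, rfl⟩

theorem map_FRC_le {V : Type*} [AddCommGroup V] [Module R V] {n : ℕ} (φ : FreeRC R ℕ →ₗ[R] V)
    (W : Submodule R V)
    (h : ∀ t : FreeMagma ℕ, content (t : RCMagma ℕ) = Multiset.range n → φ (mon R t) ∈ W)
    {f : FreeRC R ℕ} (hf : f ∈ FRC R n) : φ f ∈ W := by
  rw [FRC_eq_span] at hf
  exact (Submodule.span_le (p := W.comap φ)).2 (by rintro _ ⟨t, ht, rfl⟩; exact h t ht) hf

/-- Substitution of words for the letters of a word. -/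
def graft (g : ℕ → FreeMagma ℕ) (t : FreeMagma ℕ) : FreeMagma ℕ :=
  wordEval (fun a b => a * b) g t

theorem subst_mon (g : ℕ → FreeMagma ℕ) (t : FreeMagma ℕ) :
    subst (fun i => mon R (g i)) (mon R t) = mon R (graft g t) := by
  induction t with
  | ih1 i => exact subst_gen _ i
  | ih2 s t hs ht =>
    rw [mon_mul, subst_mul, hs, ht, ← mon_mul]
    rfl

theorem content_graft (g : ℕ → FreeMagma ℕ) (t : FreeMagma ℕ) :
    content (graft g t : RCMagma ℕ) =
      (content (t : RCMagma ℕ)).bind fun i => content (g i : RCMagma ℕ) := by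
  induction t with
  | ih1 i => exact (Multiset.singleton_bind i fun i => content (g i : RCMagma ℕ)).symm
  | ih2 s t hs ht =>
    have h1 : content ((s * t : FreeMagma ℕ) : RCMagma ℕ) = content (s : RCMagma ℕ) +
      content (t : RCMagma ℕ) := rfl
    rw [h1, Multiset.add_bind, ← hs, ← ht]
    rfl

/-- The substitution `x_i ↦ x_i x_n` on words. -/
def splitLetter (i n : ℕ) : ℕ → FreeMagma ℕ :=
  Function.update FreeMagma.of i (FreeMagma.of i * FreeMagma.of n)

theorem mon_splitLetter (i n : ℕ) : (fun j => mon R (splitLetter i n j)) =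
    Function.update (gen R) i (gen R i * gen R n) := by
  ext1 j
  by_cases h : j = i
  · subst h
    simp [splitLetter, mon_mul, mon_of]
  · simp [splitLetter, h, mon_of]

theorem content_graft_splitLetter {i n : ℕ} (hi : i < n) {t : FreeMagma ℕ}
    (ht : content (t : RCMagma ℕ) = Multiset.range n) :
    content (graft (splitLetter i n) t : RCMagma ℕ) = Multiset.range (n + 1) := by
  have h : ∀ j, content (splitLetter i n j : RCMagma ℕ) = {j} + if j = i then {n} else 0 := by
    intro j
    by_cases h : j = i
    · subst h
      simp only [splitLetter, Function.update_self, if_true]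
      rfl
    · simp only [splitLetter, Function.update_of_ne h, if_neg h, add_zero]
      rfl
  rw [content_graft, ht]
  simp only [h, Multiset.bind_add]
  rw [Multiset.range_succ, ← Multiset.singleton_add, add_comm]
  -- The letter `i` occurs exactly once, so the substitution adds exactly one `n`.
  have h1 : ((Multiset.range n).bind fun j => if j = i then ({n} : Multiset ℕ) else 0) = {n} := by
    rw [← Multiset.cons_erase (Multiset.mem_range.2 hi), Multiset.cons_bind, if_pos rfl,
      Multiset.bind_congr (g := fun _ => 0), Multiset.bind_zero, add_zero]
    intro j hj
    exact if_neg ((Multiset.nodup_range n).mem_erase_iff.1 hj).1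
  rw [h1, Multiset.bind_singleton, Multiset.map_id']

theorem liftings_mem_FRC {n : ℕ} {f g : FreeRC R ℕ} (hf : f ∈ FRC R n) (hg : g ∈ liftings n f) :
    g ∈ FRC R (n + 1) := by
  have key : ∀ t s : FreeMagma ℕ, content ((s * t : FreeMagma ℕ) : RCMagma ℕ) =
    content (s : RCMagma ℕ) + content (t : RCMagma ℕ) := fun _ _ => rfl
  rcases hg with ⟨i, hi, rfl⟩ | rfl | rfl
  · rw [← mon_splitLetter]
    refine map_FRC_le (subst _) _ (fun t ht => ?_) hf
    rw [subst_mon]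
    exact mon_mem_FRC (content_graft_splitLetter hi ht)
  · refine map_FRC_le (LinearMap.mulRight R (gen R n)) _ (fun t ht => ?_) hf
    rw [LinearMap.mulRight_apply, ← mon_of, ← mon_mul]
    refine mon_mem_FRC ?_
    rw [key, ht, content_of, Multiset.range_succ, ← Multiset.singleton_add, add_comm]
  · refine map_FRC_le (LinearMap.mulLeft R (gen R n)) _ (fun t ht => ?_) hf
    rw [LinearMap.mulLeft_apply, ← mon_of, ← mon_mul]
    refine mon_mem_FRC ?_
    rw [key, ht, content_of, Multiset.range_succ, ← Multiset.singleton_add]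

theorem J_mem_FRC : J R ∈ FRC R 4 := by
  simp only [J, ← mon_of, ← mon_mul]
  refine sub_mem (sub_mem (sub_mem (add_mem (add_mem ?_ ?_) ?_) ?_) ?_) ?_ <;>
    exact mon_mem_FRC (by decide)

theorem K_mem_FRC : K R ∈ FRC R 4 := by
  simp only [K, ← mon_of, ← mon_mul]
  refine add_mem (sub_mem (sub_mem (sub_mem (add_mem ?_ ?_) ?_) ?_) ?_) ?_ <;>
    exact mon_mem_FRC (by decide)

theorem liftingsJK_mem_FRC (k : ℕ) : ∀ f ∈ liftingsJK R k, f ∈ FRC R (4 + k) := by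
  induction k with
  | zero =>
    rintro f (rfl | rfl)
    exacts [J_mem_FRC, K_mem_FRC]
  | succ k ih =>
    rintro g ⟨f, hf, hg⟩
    exact liftings_mem_FRC (ih f hf) hg

/-- Renaming of the variables. -/
noncomputable def rename (R : Type u) [CommRing R] (σ : ℕ → ℕ) : FreeRC R ℕ →ₗ[R] FreeRC R ℕ :=
  subst fun i => gen R (σ i)

theorem rename_mon (σ : ℕ → ℕ) (t : FreeMagma ℕ) :
    rename R σ (mon R t) = mon R (graft (fun i => FreeMagma.of (σ i)) t) :=
  subst_mon (fun i => FreeMagma.of (σ i)) t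

theorem map_perm_range {n : ℕ} {σ : Equiv.Perm ℕ} (hσ : ∀ i, n ≤ i → σ i = i) :
    (Multiset.range n).map σ = Multiset.range n := by
  have hlt : ∀ i, σ i < n ↔ i < n := by
    intro i
    constructor
    · intro h
      by_contra hi
      rw [hσ i (not_lt.1 hi)] at h
      exact hi h
    · intro h
      by_contra hi
      have := σ.injective (hσ _ (not_lt.1 hi))
      omega
  refine (Multiset.Nodup.ext ((Multiset.nodup_range n).map σ.injective)
    (Multiset.nodup_range n)).2 fun a => ?_
  simp only [Multiset.mem_map, Multiset.mem_range]
  constructor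
  · rintro ⟨b, hb, rfl⟩
    exact (hlt b).2 hb
  · intro ha
    exact ⟨σ.symm a, by rw [← hlt]; simpa using ha, by simp⟩

theorem content_graft_perm {n : ℕ} {σ : Equiv.Perm ℕ} (hσ : ∀ i, n ≤ i → σ i = i)
    {t : FreeMagma ℕ} (ht : content (t : RCMagma ℕ) = Multiset.range n) :
    content (graft (fun i => FreeMagma.of (σ i)) t : RCMagma ℕ) = Multiset.range n := by
  rw [content_graft, ht]
  simp only [content_of]
  rw [Multiset.bind_singleton, map_perm_range hσ]

theorem rename_mem_FRC {n : ℕ} {σ : Equiv.Perm ℕ} (hσ : ∀ i, n ≤ i → σ i = i) {f : FreeRC R ℕ}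
    (hf : f ∈ FRC R n) : rename R σ f ∈ FRC R n :=
  map_FRC_le (rename R σ) _
    (fun t ht => by rw [rename_mon]; exact mon_mem_FRC (content_graft_perm hσ ht)) hf

theorem rename_rename (σ τ : ℕ → ℕ) (f : FreeRC R ℕ) :
    rename R σ (rename R τ f) = rename R (fun i => σ (τ i)) f := by
  refine (eval_subst _ _ _ _ f).trans ?_
  congr 1
  congr 1
  funext i
  exact eval_gen _ _ _ _

theorem rename_id (f : FreeRC R ℕ) : rename R (fun i => i) f = f :=
  (eq_eval (LinearMap.mul R (FreeRC R ℕ)) freeRC_mul_right_comm LinearMap.id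
    (fun _ _ => rfl) f).symm

theorem liftedIdentities_le_FRC (k : ℕ) : liftedIdentities R k ≤ FRC R (4 + k) := by
  refine Submodule.span_le.2 ?_
  rintro g ⟨σ, hσ, f, hf, rfl⟩
  exact rename_mem_FRC hσ (liftingsJK_mem_FRC k f hf)

theorem rename_mem_liftedIdentities {k : ℕ} {σ : Equiv.Perm ℕ} (hσ : ∀ i, 4 + k ≤ i → σ i = i)
    {f : FreeRC R ℕ} (hf : f ∈ liftedIdentities R k) : rename R σ f ∈ liftedIdentities R k := by
  have h : liftedIdentities R k ≤ (liftedIdentities R k).comap (rename R σ) := by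
    refine Submodule.span_le.2 ?_
    rintro g ⟨τ, hτ, f, hf, rfl⟩
    rw [SetLike.mem_coe, Submodule.mem_comap]
    have hστ : rename R σ (rename R τ f) = rename R (σ * τ : Equiv.Perm ℕ) f :=
      rename_rename σ τ f
    refine Submodule.subset_span ⟨σ * τ, fun i hi => ?_, f, hf, hστ⟩
    rw [Equiv.Perm.mul_apply, hτ i hi, hσ i hi]
  exact h hf

end Multilinear

/-! ### Sparse Gaussian elimination modulo 101

The functions of this section are evaluated by the kernel. They are written with recursors and in
continuation-passing style (`frc`, `SparseVec.force`, `PivotTree.ins`), so that intermediate results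
are brought to normal form before they are used. -/

/-- A sparse vector: a list of pairs of an index and a coefficient. -/
inductive SparseVec : Type
  | nil : SparseVec
  | cons : ℕ → ℕ → SparseVec → SparseVec

/-- A binary search tree of sparse vectors. -/
inductive PivotTree : Type
  | leaf : PivotTree
  | node : ℕ → SparseVec → PivotTree → PivotTree → PivotTree

theorem fact_prime_101 : Fact (Nat.Prime 101) := ⟨by norm_num⟩

attribute [local instance] fact_prime_101

noncomputable section

/-- Evaluation of a numeral before its use. -/
def frc {α : Type} (x : ℕ) (f : ℕ → α) : α :=
  Nat.rec (f 0) (fun n _ => f (Nat.succ n)) x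

theorem frc_eq {α : Type} (x : ℕ) (f : ℕ → α) : frc x f = f x := by
  cases x <;> rfl

/-- Three-way comparison of numerals. -/
def cmpNat {α : Type} (x y : ℕ) (lt eq gt : α) : α :=
  Bool.rec gt (Bool.rec lt eq (Nat.ble y x)) (Nat.ble x y)

/-- Only the middle branch provides a fact. The linear algebra below does not depend on lists being
sorted or trees being ordered; order affects only what the elimination finds. -/
theorem cmpNat_cases {α : Type} {P : α → Prop} {x y : ℕ} {lt eq gt : α} (hlt : P lt)
    (heq : x = y → P eq) (hgt : P gt) : P (cmpNat x y lt eq gt) := by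
  unfold cmpNat
  cases h : Nat.ble x y with
  | false => exact hgt
  | true =>
    cases h' : Nat.ble y x with
    | false => exact hlt
    | true => exact heq (le_antisymm (Nat.le_of_ble_eq_true h) (Nat.le_of_ble_eq_true h'))

namespace SparseVec

/-- The vector that a sparse vector represents. -/
def toFinsupp (r : SparseVec) : ℕ →₀ ZMod 101 :=
  SparseVec.rec 0 (fun k c _ v => Finsupp.single k (c : ZMod 101) + v) r

@[simp] theorem toFinsupp_nil : toFinsupp nil = 0 := rfl

@[simp] theorem toFinsupp_cons (k c : ℕ) (r : SparseVec) :
    toFinsupp (cons k c r) = Finsupp.single k (c : ZMod 101) + toFinsupp r := rfl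

/-- Evaluation of a sparse vector before its use. -/
def force {α : Type} (r : SparseVec) : (SparseVec → α) → α :=
  SparseVec.rec (fun K => K .nil)
    (fun k c _ ih K => frc k fun k => frc c fun c => ih fun r => K (.cons k c r)) r

theorem force_eq {α : Type} (r : SparseVec) (K : SparseVec → α) : r.force K = K r := by
  induction r generalizing K with
  | nil => rfl
  | cons k c r ih =>
    change (frc k fun k => frc c fun c => r.force fun r => K (.cons k c r)) = _
    simp only [frc_eq, ih]

/-- Multiplication by a scalar. -/
def scale (c : ℕ) (s : SparseVec) : SparseVec :=
  SparseVec.rec .nil (fun k x _ ih => .cons k (Nat.mod (Nat.mul c x) 101) ih) s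

theorem natCast_mod_eq (x : ℕ) : ((Nat.mod x 101 : ℕ) : ZMod 101) = x :=
  ZMod.natCast_mod x 101

theorem toFinsupp_scale (c : ℕ) (s : SparseVec) :
    (scale c s).toFinsupp = (c : ZMod 101) • s.toFinsupp := by
  induction s with
  | nil => simp [scale]
  | cons k x s ih =>
    change Finsupp.single k ((Nat.mod (Nat.mul c x) 101 : ℕ) : ZMod 101) + (scale c s).toFinsupp = _
    rw [ih, natCast_mod_eq, Nat.mul_eq, Nat.cast_mul, toFinsupp_cons, smul_add, Finsupp.smul_single,
      smul_eq_mul]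

/-- The sum of a vector and a multiple of another one. -/
def addMul (c : ℕ) (r : SparseVec) : SparseVec → SparseVec :=
  SparseVec.rec (scale c) (fun k x _ f s =>
    SparseVec.rec (motive := fun _ => SparseVec) (.cons k x (f .nil))
      (fun l y s ih => cmpNat k l (.cons k x (f (.cons l y s)))
        (Nat.rec (f s) (fun n _ => .cons k (Nat.succ n) (f s))
          (Nat.mod (Nat.add x (Nat.mul c y)) 101))
        (.cons l (Nat.mod (Nat.mul c y) 101) ih)) s) r

theorem toFinsupp_addMul (c : ℕ) (r s : SparseVec) :
    (addMul c r s).toFinsupp = r.toFinsupp + (c : ZMod 101) • s.toFinsupp := by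
  induction r generalizing s with
  | nil => rw [toFinsupp_nil, zero_add, ← toFinsupp_scale]; rfl
  | cons k x r ihr =>
    induction s with
    | nil =>
      change Finsupp.single k (x : ZMod 101) + (addMul c r .nil).toFinsupp = _
      rw [ihr]
      simp
    | cons l y s ihs =>
      change (cmpNat k l (SparseVec.cons k x (addMul c r (.cons l y s)))
        (Nat.rec (addMul c r s) (fun n _ => .cons k (Nat.succ n) (addMul c r s))
          (Nat.mod (Nat.add x (Nat.mul c y)) 101))
        (.cons l (Nat.mod (Nat.mul c y) 101) (addMul c (.cons k x r) s))).toFinsupp = _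
      refine cmpNat_cases (P := fun t : SparseVec => t.toFinsupp = _) ?_ (fun hkl => ?_) ?_
      · rw [toFinsupp_cons, ihr, toFinsupp_cons k, add_assoc]
      · subst hkl
        have hcast := natCast_mod_eq (Nat.add x (Nat.mul c y))
        have hsum : (cons k x r).toFinsupp + (c : ZMod 101) • (cons k y s).toFinsupp =
            Finsupp.single k ((Nat.add x (Nat.mul c y) : ℕ) : ZMod 101) +
              (addMul c r s).toFinsupp := by
          rw [ihr, toFinsupp_cons, toFinsupp_cons, smul_add, Finsupp.smul_single, smul_eq_mul,
            Nat.add_eq, Nat.mul_eq, Nat.cast_add, Nat.cast_mul, Finsupp.single_add]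
          abel
        rw [hsum, ← hcast]
        -- A sum that vanishes modulo 101 is dropped from the list, which leaves the vector
        -- unchanged.
        cases Nat.mod (Nat.add x (Nat.mul c y)) 101 with
        | zero => simp
        | succ n => rfl
      · rw [toFinsupp_cons, ihs, natCast_mod_eq, Nat.mul_eq, Nat.cast_mul, toFinsupp_cons l,
          smul_add, Finsupp.smul_single, smul_eq_mul]
        abel

/-- The sum of a list of entries, given as pairs of an index and a coefficient. -/
def ofEntries {α : Type} (l : List (ℕ × ℕ)) : SparseVec → (SparseVec → α) → α :=
  List.rec (fun r K => r.force K)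
    (fun e _ ih r K => frc (Prod.snd e) fun c => Nat.rec (ih r K)
      (fun n _ => frc (Prod.fst e) fun k => ih (addMul 1 r (.cons k (Nat.succ n) .nil)) K) c) l

/-- A single `s` serves all continuations, so code in continuation-passing style can be replaced by
a statement about one vector. -/
theorem ofEntries_spec (l : List (ℕ × ℕ)) (r : SparseVec) :
    ∃ s : SparseVec, s.toFinsupp = r.toFinsupp +
      (l.map fun e => Finsupp.single e.1 (e.2 : ZMod 101)).sum ∧
      ∀ {α : Type} (K : SparseVec → α), ofEntries l r K = K s := by
  induction l generalizing r with
  | nil => exact ⟨r, by simp, fun K => force_eq r K⟩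
  | cons e l ih =>
    obtain ⟨k, c⟩ := e
    cases c with
    | zero =>
      obtain ⟨s, hs, hK⟩ := ih r
      exact ⟨s, by simpa using hs, fun K => hK K⟩
    | succ n =>
      obtain ⟨s, hs, hK⟩ := ih (addMul 1 r (.cons k (Nat.succ n) .nil))
      refine ⟨s, ?_, fun K => ?_⟩
      · rw [hs, toFinsupp_addMul]
        simp [add_assoc]
      · refine Eq.trans (b := frc k fun k =>
          ofEntries l (addMul 1 r (.cons k (Nat.succ n) .nil)) K) rfl ?_
        rw [frc_eq]
        exact hK K

/-- All indices are at least `b`. -/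
def keysGe (b : ℕ) (r : SparseVec) : Bool :=
  SparseVec.rec true (fun k _ _ ih => and (Nat.ble b k) ih) r

theorem toFinsupp_apply_of_keysGe {b : ℕ} {r : SparseVec} (h : r.keysGe b = true) {j : ℕ}
    (hj : j < b) : r.toFinsupp j = 0 := by
  induction r with
  | nil => rfl
  | cons k c r ih =>
    obtain ⟨h1, h2⟩ := (Bool.and_eq_true _ _).mp h
    have hk : k ≠ j := (hj.trans_le (Nat.le_of_ble_eq_true h1)).ne'
    rw [toFinsupp_cons, Finsupp.add_apply, ih h2, Finsupp.single_eq_of_ne' hk, add_zero]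

/-- The leading indices of the vectors increase, and the first one is at least `b`. -/
def echelon (l : List SparseVec) : ℕ → Bool :=
  List.rec (fun _ => true) (fun r _ ih b => SparseVec.rec (motive := fun _ => Bool) false
    (fun k c r' _ => and (Nat.ble b k) (and (Nat.ble 1 (Nat.mod c 101))
      -- The bound on the tail excludes a second entry at index `k`, which could cancel the leading
      -- coefficient.
      (and (r'.keysGe (Nat.succ k)) (ih (Nat.succ k))))) r) l

/-- All later vectors vanish at the leading index of the first one, which therefore lies outside
their span. Hence each vector raises the dimension. The vanishing below `b` is what carries the
induction. -/
theorem echelon_spec {l : List SparseVec} {b : ℕ} (h : echelon l b = true) :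
    (∀ r ∈ l, ∀ j < b, r.toFinsupp j = 0) ∧
      l.length ≤ Module.finrank (ZMod 101)
        ↥(Submodule.span (ZMod 101) (toFinsupp '' {r | r ∈ l})) := by
  induction l generalizing b with
  | nil => simp
  | cons r l ih =>
    cases r with
    | nil => exact absurd h (by simp [echelon])
    | cons k c r =>
      obtain ⟨h1, h'⟩ := (Bool.and_eq_true _ _).mp h
      obtain ⟨h2, h'⟩ := (Bool.and_eq_true _ _).mp h'
      obtain ⟨h3, h4⟩ := (Bool.and_eq_true _ _).mp h'
      obtain ⟨ih1, ih2⟩ := ih h4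
      have hbk : b ≤ k := Nat.le_of_ble_eq_true h1
      refine ⟨?_, ?_⟩
      · intro s hs j hj
        rcases List.mem_cons.1 hs with rfl | hs
        · rw [toFinsupp_cons, Finsupp.add_apply,
            toFinsupp_apply_of_keysGe h3 (hj.trans_le (hbk.trans k.le_succ)),
            Finsupp.single_eq_of_ne' (hj.trans_le hbk).ne', add_zero]
        · exact ih1 s hs j (hj.trans_le (hbk.trans k.le_succ))
      · have hset : {s | s ∈ SparseVec.cons k c r :: l} =
            insert (SparseVec.cons k c r) {s | s ∈ l} := by
          ext s
          simp
        have hfin : ∀ m : List SparseVec,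
            FiniteDimensional (ZMod 101) ↥(Submodule.span (ZMod 101) (toFinsupp '' {s | s ∈ m})) :=
          fun m => FiniteDimensional.span_of_finite _ ((List.finite_toSet m).image _)
        have := hfin (SparseVec.cons k c r :: l)
        rw [List.length_cons, Nat.succ_le_iff]
        refine ih2.trans_lt (Submodule.finrank_lt_finrank_of_lt (lt_of_le_of_ne ?_ ?_))
        · exact Submodule.span_mono (Set.image_mono (by rw [hset]; exact Set.subset_insert _ _))
        · intro heq
          have hmem : (SparseVec.cons k c r).toFinsupp ∈
              Submodule.span (ZMod 101) (toFinsupp '' {s | s ∈ l}) := by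
            rw [heq]
            exact Submodule.subset_span ⟨_, by simp, rfl⟩
          have hle : Submodule.span (ZMod 101) (toFinsupp '' {s | s ∈ l}) ≤
              LinearMap.ker (Finsupp.lapply k : (ℕ →₀ ZMod 101) →ₗ[ZMod 101] ZMod 101) := by
            refine Submodule.span_le.2 ?_
            rintro _ ⟨s, hs, rfl⟩
            exact ih1 s hs k k.lt_succ_self
          have hzero : (SparseVec.cons k c r).toFinsupp k = 0 := hle hmem
          rw [toFinsupp_cons, Finsupp.add_apply, toFinsupp_apply_of_keysGe h3 k.lt_succ_self,
            Finsupp.single_eq_same, add_zero, ZMod.natCast_eq_zero_iff] at hzero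
          have h5 : 1 ≤ c % 101 := Nat.le_of_ble_eq_true h2
          omega

end SparseVec

namespace PivotTree

open SparseVec

/-- The vectors in a tree. -/
def toList (t : PivotTree) : List SparseVec → List SparseVec :=
  PivotTree.rec (fun l => l) (fun _ r _ _ iha ihb l => iha (r :: ihb l)) t

/-- Search for a pivot. -/
def find {α : Type} (x : ℕ) (t : PivotTree) (no : α) (yes : SparseVec → α) : α :=
  PivotTree.rec no (fun k r _ _ iha ihb => cmpNat x k iha (yes r) ihb) t

/-- Insertion of a pivot. -/
def ins {α : Type} (x : ℕ) (v : SparseVec) (t : PivotTree) : (PivotTree → α) → α :=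
  PivotTree.rec (fun K => K (.node x v .leaf .leaf))
    (fun k r a b iha ihb K => cmpNat x k (iha fun a => K (.node k r a b)) (K (.node k r a b))
      (ihb fun b => K (.node k r a b))) t

/-- Reduction of a vector by the pivots, and insertion of the result as a new pivot. -/
def reduce {α : Type} (fuel : ℕ) (t : PivotTree) (K : PivotTree → α) : SparseVec → α :=
  Nat.rec (motive := fun _ => SparseVec → α) (fun _ => K t) (fun _ ih r =>
    SparseVec.rec (motive := fun _ => α) (K t) (fun k c r' _ => frc k fun k => frc c fun c =>
      -- By Fermat, c⁹⁹ is the inverse of c modulo 101, so a new pivot has leading coefficient 1.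
      t.find k ((scale (Nat.mod (Nat.pow c 99) 101) (.cons k c r')).force fun r => t.ins k r K)
        -- Since the pivot has leading coefficient 1, adding 101 − c times it cancels the leading
        -- entry.
        (fun p => ih (addMul (Nat.sub 101 c) (.cons k c r') p))) r) fuel

/-- Elimination for a list of vectors. -/
def elim {ι : Type} (row : ι → (SparseVec → PivotTree) → PivotTree) (l : List ι) :
    PivotTree → PivotTree :=
  -- If 1000 reduction steps did not suffice, the row would be discarded; this could only lower the
  -- dimension found.
  List.rec (fun t => t) (fun i _ ih t => row i fun r => reduce 1000 t ih r) l

/-- All vectors in the tree lie in a given subspace. -/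
def All (M : Submodule (ZMod 101) (ℕ →₀ ZMod 101)) (t : PivotTree) : Prop :=
  PivotTree.rec True (fun _ r _ _ a b => r.toFinsupp ∈ M ∧ a ∧ b) t

variable {M : Submodule (ZMod 101) (ℕ →₀ ZMod 101)}

theorem All.mem_toList {t : PivotTree} (h : t.All M) {l : List SparseVec}
    (hl : ∀ r ∈ l, r.toFinsupp ∈ M) : ∀ r ∈ t.toList l, r.toFinsupp ∈ M := by
  induction t generalizing l with
  | leaf => exact hl
  | node k r a b iha ihb =>
    refine iha h.2.1 fun s hs => ?_
    rcases List.mem_cons.1 hs with rfl | hs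
    · exact h.1
    · exact ihb h.2.2 hl s hs

theorem All.find {t : PivotTree} (h : t.All M) {α : Type} {P : α → Prop} (x : ℕ) {no : α}
    {yes : SparseVec → α} (hno : P no) (hyes : ∀ r : SparseVec, r.toFinsupp ∈ M → P (yes r)) :
    P (t.find x no yes) := by
  induction t with
  | leaf => exact hno
  | node k r a b iha ihb => exact cmpNat_cases (iha h.2.1) (fun _ => hyes r h.1) (ihb h.2.2)

theorem All.ins {t : PivotTree} (h : t.All M) {α : Type} {P : α → Prop} (x : ℕ) {v : SparseVec}
    (hv : v.toFinsupp ∈ M) {K : PivotTree → α} (hK : ∀ t : PivotTree, t.All M → P (K t)) :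
    P (t.ins x v K) := by
  induction t generalizing K with
  | leaf => exact hK _ ⟨hv, trivial, trivial⟩
  | node k r a b iha ihb =>
    exact cmpNat_cases (iha h.2.1 fun a ha => hK _ ⟨h.1, ha, h.2.2⟩) (fun _ => hK _ h)
      (ihb h.2.2 fun b hb => hK _ ⟨h.1, h.2.1, hb⟩)

/-- Reduction only rescales and adds multiples of pivots, so it never leaves `M`. Neither the choice
of the scalars nor the amount of fuel matters here. -/
theorem All.reduce {t : PivotTree} (h : t.All M) {α : Type} {P : α → Prop} (fuel : ℕ)
    {r : SparseVec} (hr : r.toFinsupp ∈ M) {K : PivotTree → α}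
    (hK : ∀ t : PivotTree, t.All M → P (K t)) : P (reduce fuel t K r) := by
  induction fuel generalizing r with
  | zero => exact hK t h
  | succ n ih =>
    cases r with
    | nil => exact hK t h
    | cons k c r =>
      change P (frc k fun k => frc c fun c => t.find k
        ((scale (Nat.mod (Nat.pow c 99) 101) (.cons k c r)).force fun r => t.ins k r K)
        (fun p => PivotTree.reduce n t K (addMul (Nat.sub 101 c) (.cons k c r) p)))
      rw [frc_eq, frc_eq, force_eq]
      refine h.find k (h.ins k ?_ hK) fun p hp => ih ?_
      · rw [toFinsupp_scale]
        exact M.smul_mem _ hr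
      · rw [toFinsupp_addMul]
        exact M.add_mem hr (M.smul_mem _ hp)

theorem All.elim {ι : Type} {row : ι → (SparseVec → PivotTree) → PivotTree} {l : List ι}
    (hrow : ∀ i ∈ l, ∃ r : SparseVec, r.toFinsupp ∈ M ∧ ∀ K, row i K = K r) {t : PivotTree}
    (h : t.All M) : (elim row l t).All M := by
  induction l generalizing t with
  | nil => exact h
  | cons i l ih =>
    obtain ⟨r, hr, hK⟩ := hrow i (by simp)
    change (row i fun r => PivotTree.reduce 1000 t (PivotTree.elim row l) r).All M
    rw [hK]
    exact h.reduce 1000 hr fun t ht => ih (fun j hj => hrow j (by simp [hj])) ht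

/-- The tree holds `n` vectors in echelon form. -/
def check (n : ℕ) (t : PivotTree) : Bool :=
  and (echelon (t.toList []) 0) (Nat.beq (t.toList []).length n)

/-- A subspace that contains the given vectors has at least the dimension that elimination finds. -/
theorem le_finrank_of_check {ι : Type} {row : ι → (SparseVec → PivotTree) → PivotTree} {l : List ι}
    [FiniteDimensional (ZMod 101) M]
    (hrow : ∀ i ∈ l, ∃ r : SparseVec, r.toFinsupp ∈ M ∧ ∀ K, row i K = K r) {n : ℕ}
    (h : (elim row l .leaf).check n = true) : n ≤ Module.finrank (ZMod 101) M := by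
  obtain ⟨h1, h2⟩ := (Bool.and_eq_true _ _).mp h
  rw [← Nat.eq_of_beq_eq_true h2]
  refine (echelon_spec h1).2.trans (Submodule.finrank_mono (Submodule.span_le.2 ?_))
  rintro _ ⟨r, hr, rfl⟩
  have hleaf : PivotTree.leaf.All M := trivial
  exact (hleaf.elim hrow).mem_toList (by simp) r hr

end PivotTree

end

noncomputable section

/-! ### Coordinates of right-commutative monomials -/

/-- Numerical data of a right-commutative monomial `x u₁ ⋯ u_k`: its first letter, the number of
factors, codes of the sequence of degrees of the factors and of the sequence of the factors,
its degree, and a code of the monomial up to commutativity. -/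
structure MonCode : Type where
  head : ℕ
  factors : ℕ
  pattern : ℕ
  flat : ℕ
  degree : ℕ
  code : ℕ

namespace MonCode

/-- The code of a letter. -/
def letter (i : ℕ) : MonCode := ⟨i, 0, 0, 0, 1, i⟩

/-- The smaller of two numbers. -/
def lo (x y : ℕ) : ℕ := Nat.sub x (Nat.sub x y)

/-- The larger of two numbers. -/
def hi (x y : ℕ) : ℕ := Nat.add x (Nat.sub y x)

theorem lo_comm (x y : ℕ) : lo x y = lo y x := by
  simp only [lo, Nat.sub_eq]
  omega

theorem hi_comm (x y : ℕ) : hi x y = hi y x := by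
  simp only [hi, Nat.sub_eq, Nat.add_eq]
  omega

/-- The number of symbols of the code of a monomial up to commutativity. -/
def width (d : ℕ) : ℕ := Nat.sub (Nat.mul 2 d) 1

/-- The code of a product. -/
def mul (a b : MonCode) : MonCode where
  head := a.head
  factors := Nat.succ a.factors
  pattern := Nat.add (Nat.mul a.pattern 8) b.degree
  -- A factor of degree d has a code of at most 2d − 1 octal digits and receives a slot of 2d
  -- digits.
  flat := Nat.add a.flat (Nat.mul b.code (Nat.pow 8 (Nat.mul 2 a.degree)))
  degree := Nat.add a.degree b.degree
  -- Prefix notation in base 8: the digit 7 marks a product, the letters being at most 5. For such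
  -- letters the codes of higher degree are larger, so the smaller code fits the smaller width.
  code := Nat.add (Nat.mul (Nat.add (Nat.mul 7 (Nat.pow 8 (width (lo a.degree b.degree))))
    (lo a.code b.code)) (Nat.pow 8 (width (hi a.degree b.degree)))) (hi a.code b.code)

/-- A right factor enters only through its degree and its code, and both are symmetric. This makes
the code well defined on right-commutative monomials. -/
theorem mul_right_comm (a b c : MonCode) : mul a (mul b c) = mul a (mul c b) := by
  have h1 : (mul b c).degree = (mul c b).degree := Nat.add_comm _ _
  have h2 : (mul b c).code = (mul c b).code := by
    simp only [mul, lo_comm b.degree, lo_comm b.code, hi_comm b.degree, hi_comm b.code]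
  simp only [mul.eq_1 a, h1, h2]

/-- The index of a monomial. -/
def index (a : MonCode) : ℕ :=
  -- In degree 6 the pattern is below 8⁶ and the flat code below 8¹². Monomials with few factors
  -- come first and are eliminated first.
  Nat.add (Nat.mul (Nat.add (Nat.mul a.factors (Nat.pow 8 6)) a.pattern) (Nat.pow 8 12)) a.flat

end MonCode

/-- The code of a word. -/
def wordCode (g : ℕ → ℕ) (t : FreeMagma ℕ) : MonCode :=
  FreeMagma.rec (fun i => MonCode.letter (g i)) (fun _ _ a b => a.mul b) t

/-! ### Liftings of the two identities as lists of monomials -/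

/-- The function with a given list of values, continued by the identity. -/
def listFun (l : List ℕ) (i : ℕ) : ℕ :=
  List.rec (fun _ => i) (fun a _ ih j => Nat.rec a (fun n _ => ih n) j) l i

/-- The terms of `J`. -/
def termsJ : List (FreeMagma ℕ × ℕ) :=
  let a := FreeMagma.of 0
  let b := FreeMagma.of 1
  let c := FreeMagma.of 2
  let d := FreeMagma.of 3
  [((a.mul (b.mul c)).mul d, 1), ((a.mul (b.mul d)).mul c, 1), ((a.mul (c.mul d)).mul b, 1),
    ((a.mul b).mul (c.mul d), 100), ((a.mul c).mul (b.mul d), 100), ((a.mul d).mul (b.mul c), 100)]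

/-- The terms of `K`. -/
def termsK : List (FreeMagma ℕ × ℕ) :=
  let a := FreeMagma.of 0
  let b := FreeMagma.of 1
  let c := FreeMagma.of 2
  let d := FreeMagma.of 3
  [(((a.mul b).mul d).mul c, 1), (((a.mul c).mul d).mul b, 1), ((a.mul (b.mul c)).mul d, 100),
    ((a.mul (b.mul d)).mul c, 100), ((a.mul (c.mul d)).mul b, 100), (a.mul ((b.mul c).mul d), 1)]

/-- The substitution `x_i ↦ x_i x_n`. -/
def splitWord (n i : ℕ) (t : FreeMagma ℕ) : FreeMagma ℕ :=
  FreeMagma.rec (fun j => Bool.rec (.of j) ((FreeMagma.of i).mul (.of n)) (Nat.beq j i))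
    (fun _ _ a b => a.mul b) t

/-- The substitution `x_i ↦ x_i x_n` for `i < n`, and multiplication by `x_n` for `n ≤ i`. -/
def liftWord (n i : ℕ) (t : FreeMagma ℕ) : FreeMagma ℕ :=
  Bool.rec (t.mul (.of n)) (splitWord n i t) (Nat.blt i n)

/-- A lifting of a list of terms. -/
def liftTerms (n i : ℕ) (p : List (FreeMagma ℕ × ℕ)) : List (FreeMagma ℕ × ℕ) :=
  p.map fun e => (liftWord n i e.1, e.2)

/-- The arrangements of a list of length `n`. -/
def arrangements : ℕ → List ℕ → List (List ℕ)
  | 0, _ => [[]]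
  | n + 1, l => l.flatMap fun a => (arrangements n (l.erase a)).map (a :: ·)

/-- The arrangements `s` of `1, …, 5` with `s_i < s_j` for given pairs `(i, j)` of positions,
preceded by `0`. -/
def arrangementsWith (c : List (ℕ × ℕ)) : List (List ℕ) :=
  ((arrangements 5 [1, 2, 3, 4, 5]).map (0 :: ·)).filter fun s =>
    c.all fun e => Nat.blt (listFun s e.1) (listFun s e.2)

/-- Liftings to degree `6`, each with a set of permutations of the variables. -/
def liftingTable : List ((List (FreeMagma ℕ × ℕ) × ℕ × ℕ) × List (ℕ × ℕ)) :=
  -- The two numbers are the positions of the successive liftings; 4 in the first place and 5 in the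
  -- second mean right multiplication. The inequalities select representatives under symmetries of
  -- the lifted identity, such as b ↔ c in `K`. Left multiplications are absent, since they would
  -- change the first letter.
  [((termsK, 3, 5), [(1, 2), (3, 4)]), ((termsK, 0, 1), [(1, 5)]),
    ((termsK, 0, 3), [(1, 2), (3, 5)]), ((termsK, 4, 4), [(1, 2), (4, 5)]),
    ((termsK, 0, 4), [(1, 2), (4, 5)]), ((termsK, 0, 5), [(1, 2)]), ((termsK, 1, 1), [(1, 5)]),
    ((termsK, 1, 2), [(1, 4), (2, 5), (1, 2)]), ((termsK, 0, 0), [(1, 2)]),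
    ((termsK, 1, 5), [(1, 4)]), ((termsK, 4, 5), [(1, 2)]), ((termsJ, 0, 0), [(1, 2), (2, 3)]),
    ((termsJ, 4, 0), [(1, 2), (2, 3)]), ((termsJ, 0, 4), [(1, 2), (2, 3), (4, 5)]),
    ((termsJ, 4, 5), [(1, 2), (2, 3)]), ((termsK, 1, 3), [(1, 4), (3, 5)]),
    ((termsJ, 1, 1), [(1, 5), (2, 3)])]

/-- The lifted identities that are used, as pairs of a list of terms and a permutation. -/
def liftingRows : List (List (FreeMagma ℕ × ℕ) × List ℕ) :=
  liftingTable.flatMap fun e => (arrangementsWith e.2).map fun s =>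
    (liftTerms 5 e.1.2.2 (liftTerms 4 e.1.2.1 e.1.1), s)

/-- The sparse vector of a lifted identity. -/
def liftingRow (e : List (FreeMagma ℕ × ℕ) × List ℕ) : (SparseVec → PivotTree) → PivotTree :=
  SparseVec.ofEntries (e.1.map fun t => ((wordCode (listFun e.2) t.1).index, t.2)) .nil

-- The target is 615 = 3690 / 6, the share of the first letter `x_0`.
set_option maxRecDepth 100000 in
theorem check_liftingRows : (PivotTree.elim liftingRow liftingRows .leaf).check 615 = true := by
  decide +kernel

end

/-! ### Expansions of words as sparse vectors -/

noncomputable section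

/-- The normal forms of the expansion of a word, each with coefficient `1`. -/
def expandWord (t : FreeMagma ℕ) : List (DiWord ℕ) :=
  FreeMagma.rec (fun i => [⟨[], i, []⟩])
    (fun _ _ a b => a.flatMap fun v => b.flatMap fun w => [v.left w, w.right v]) t

/-- The index of a dialgebra monomial. -/
def diIndex (w : DiWord ℕ) : ℕ :=
  -- In degree 6 at most five letters follow the center, and 32768 = 8⁵ leaves room for them. The
  -- initial 1 records the length of the prefix, and the subtraction puts long prefixes first.
  Nat.sub (Nat.pow 8 11) (Nat.add (Nat.mul 32768 (List.rec 1
    (fun i _ n => Nat.add (Nat.mul n 8) i) w.pre)) (List.rec (fun n => n)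
    (fun i _ ih n => frc (Nat.add (Nat.mul n 8) i) ih) w.post 0))

/-- Membership of a letter in a word, as a number. -/
def occurs (i : ℕ) (l : List ℕ) : ℕ :=
  List.rec 0 (fun a _ ih => Bool.rec ih 1 (Nat.beq a i)) l

/-- The words `t u₁ ⋯ u_k` where the `u_i` are letters or products of two letters in
increasing order. The degrees of the `u_i` are given, and their letters form a given list. -/
def extensions : List ℕ → List ℕ → FreeMagma ℕ → List (FreeMagma ℕ)
  | [], l, t => if l = [] then [t] else []
  | 1 :: p, l, t => l.flatMap fun i => extensions p (l.erase i) (t.mul (.of i))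
  | _ :: p, l, t => l.flatMap fun i => (l.erase i).flatMap fun j =>
      if i < j then extensions p ((l.erase i).erase j) (t.mul ((FreeMagma.of i).mul (.of j)))
      else []

/-- The words in the letters `0, …, 5` that begin with `0`, where all factors have degree at
most `2`. -/
def expansionWords : List (FreeMagma ℕ) :=
  -- These are all compositions of 5 into parts 1 and 2. Larger factors contribute nothing to the
  -- rank: `K` expresses a((bc)d) through right factors of smaller degree.
  [[1, 1, 1, 1, 1], [1, 1, 1, 2], [1, 1, 2, 1], [1, 2, 1, 1], [1, 2, 2], [2, 1, 1, 1], [2, 1, 2],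
    [2, 2, 1]].flatMap fun p => extensions p [1, 2, 3, 4, 5] (.of 0)

/-- The sparse vector of the expansion of a word. -/
def expansionRow (t : FreeMagma ℕ) : (SparseVec → PivotTree) → PivotTree :=
  -- Expansions are invariant under reversal of words, which moves `x_1` across the center. Keeping
  -- only the words with `x_1` in front thus halves the vectors and loses no rank.
  SparseVec.ofEntries ((expandWord t).map fun w => (diIndex w, occurs 1 w.pre)) .nil

-- The target is 330 = 1980 / 6, the share of the center `x_0`.
set_option maxRecDepth 100000 in
theorem check_expansionWords :
    (PivotTree.elim expansionRow expansionWords .leaf).check 330 = true := by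
  decide +kernel

end

/-- If the translates of `W` by the maps `τ c` are separated by the maps `π ∘ τ c`, then their span
has at least `6` times the dimension of the image of `W`. -/
theorem six_mul_finrank_le {k V N : Type*} [Field k] [AddCommGroup V] [Module k V]
    [AddCommGroup N] [Module k N] (π : V →ₗ[k] N) (τ : Fin 6 → V →ₗ[k] V) (L W : Submodule k V)
    [FiniteDimensional k L] (hWL : W ≤ L) (hτ : ∀ c, ∀ x ∈ L, τ c x ∈ L)
    (h : ∀ c c', ∀ w ∈ W, π (τ c' (τ c w)) = if c = c' then π w else 0) :
    6 * Module.finrank k (W.map π) ≤ Module.finrank k L := by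
  have hW : FiniteDimensional k W := Submodule.finiteDimensional_of_le hWL
  let H : V →ₗ[k] (Fin 6 → N) := LinearMap.pi fun c => π ∘ₗ τ c
  have hmem : ∀ a : Fin 6 → W.map π, (fun c => (a c : N)) ∈ L.map H := by
    intro a
    choose w hw using fun c => (a c).2
    -- In the sum of translates, π ∘ τ c' kills every summand but the one with index c', so
    -- arbitrary sixfold tuples from the image of `W` are attained.
    refine ⟨∑ c, τ c (w c), Submodule.sum_mem _ fun c _ => hτ c _ (hWL (hw c).1), ?_⟩
    ext c'
    simp only [H, LinearMap.pi_apply, LinearMap.comp_apply, map_sum]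
    rw [Finset.sum_eq_single c', h c' c' _ (hw c').1, if_pos rfl, (hw c').2]
    · intro c _ hc
      rw [h c c' _ (hw c).1, if_neg hc]
    · simp
  let G : (Fin 6 → W.map π) →ₗ[k] L.map H :=
    LinearMap.codRestrict _ (LinearMap.pi fun c => (W.map π).subtype ∘ₗ LinearMap.proj c) hmem
  have hG : Function.Injective G := by
    intro a b hab
    funext c
    exact Subtype.ext (congrFun (congrArg Subtype.val hab) c)
  calc 6 * Module.finrank k (W.map π) = Module.finrank k (Fin 6 → W.map π) := by
        rw [Module.finrank_pi_fintype]
        simp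
    _ ≤ Module.finrank k (L.map H) := LinearMap.finrank_le_finrank_of_injective hG
    _ ≤ Module.finrank k L := Submodule.finrank_map_le H L

/-! ### The dimension of the space of lifted identities -/

section Lifted

theorem listFun_eq_getD (l : List ℕ) (i : ℕ) : listFun l i = l.getD i i := by
  have key : ∀ (l : List ℕ) (j : ℕ), (List.rec (motive := fun _ => ℕ → ℕ) (fun _ => i)
      (fun a _ ih j => Nat.rec a (fun n _ => ih n) j) l j : ℕ) = l.getD j i := by
    intro l
    induction l with
    | nil => simp
    | cons a l ih =>
      intro j
      cases j with
      | zero => rfl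
      | succ j => simpa using ih j
  exact key l i

theorem exists_perm_eq_listFun {s : List ℕ} {n : ℕ} (hs : s.Perm (List.range n)) :
    ∃ σ : Equiv.Perm ℕ, (∀ i, σ i = listFun s i) ∧ ∀ i, n ≤ i → σ i = i := by
  have hlen : s.length = n := by simpa using hs.length_eq
  have hnd : s.Nodup := hs.nodup_iff.2 List.nodup_range
  have hlt : ∀ i (h : i < s.length), listFun s i = s[i] := fun i h => by
    rw [listFun_eq_getD, List.getD_eq_getElem _ _ h]
  have hge : ∀ i, s.length ≤ i → listFun s i = i := fun i h => by
    rw [listFun_eq_getD, List.getD_eq_default _ _ h]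
  have hval : ∀ i (h : i < s.length), s[i] < n := fun i h =>
    List.mem_range.1 (hs.mem_iff.1 (List.getElem_mem h))
  have hbij : Function.Bijective (listFun s) := by
    constructor
    · intro i j hij
      rcases lt_or_ge i s.length with hi | hi <;> rcases lt_or_ge j s.length with hj | hj
      · rw [hlt i hi, hlt j hj] at hij
        exact (hnd.getElem_inj_iff).1 hij
      · rw [hlt i hi, hge j hj] at hij
        have := hval i hi
        omega
      · rw [hge i hi, hlt j hj] at hij
        have := hval j hj
        omega
      · rwa [hge i hi, hge j hj] at hij
    · intro y
      rcases lt_or_ge y n with hy | hy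
      · obtain ⟨i, hi, h⟩ := List.getElem_of_mem (hs.mem_iff.2 (List.mem_range.2 hy))
        exact ⟨i, by rw [hlt i hi, h]⟩
      · exact ⟨y, hge y (hlen ▸ hy)⟩
  exact ⟨Equiv.ofBijective _ hbij, fun i => rfl, fun i hi => hge i (hlen ▸ hi)⟩

theorem perm_of_mem_arrangements {n : ℕ} : ∀ {l s : List ℕ}, l.length = n →
    s ∈ arrangements n l → s.Perm l := by
  induction n with
  | zero =>
    intro l s hl hs
    rw [List.length_eq_zero_iff.1 hl, List.mem_singleton.1 hs]
  | succ n ih =>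
    intro l s hl hs
    simp only [arrangements, List.mem_flatMap, List.mem_map] at hs
    obtain ⟨a, ha, s, hs, rfl⟩ := hs
    have := ih (by rw [List.length_erase_of_mem ha, hl]; rfl) hs
    exact (this.cons a).trans (List.perm_cons_erase ha).symm

theorem perm_of_mem_arrangementsWith {c : List (ℕ × ℕ)} {s : List ℕ}
    (hs : s ∈ arrangementsWith c) : s.Perm (List.range 6) := by
  obtain ⟨s, hs', rfl⟩ := List.mem_map.1 (List.mem_filter.1 hs).1
  exact (perm_of_mem_arrangements rfl hs').cons 0

/-- The code of a right-commutative monomial. -/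
def monCode (w : RCMagma ℕ) : MonCode :=
  monEval MonCode.mul MonCode.mul_right_comm MonCode.letter w

theorem monCode_graft (g : ℕ → ℕ) (t : FreeMagma ℕ) :
    monCode (graft (fun i => FreeMagma.of (g i)) t : RCMagma ℕ) = wordCode g t := by
  change wordEval MonCode.mul MonCode.letter (graft (fun i => FreeMagma.of (g i)) t) = _
  induction t with
  | ih1 i => rfl
  | ih2 a b ha hb => exact congrArg₂ MonCode.mul ha hb

/-- A product inherits the first letter of its left factor, so renaming acts on first letters as it
does on variables. -/
theorem head_monCode_graft (g : ℕ → ℕ) (t : FreeMagma ℕ) :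
    (monCode (graft (fun i => FreeMagma.of (g i)) t : RCMagma ℕ)).head =
      g (monCode (t : RCMagma ℕ)).head := by
  rw [monCode_graft]
  induction t with
  | ih1 i => rfl
  | ih2 a b ha hb => exact ha

/-- The coordinates of the monomials that begin with `x_0`. -/
noncomputable def monCoord : FreeRC (ZMod 101) ℕ →ₗ[ZMod 101] (ℕ →₀ ZMod 101) :=
  -- Injectivity of the index is never needed: a linear image can only have smaller dimension.
  Finsupp.linearCombination (ZMod 101) (fun w : RCMagma ℕ => if (monCode w).head = 0 then
    Finsupp.single (monCode w).index (1 : ZMod 101) else 0) ∘ₗ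
      (MonoidAlgebra.coeffLinearEquiv (ZMod 101)).toLinearMap

theorem monCoord_mon (t : FreeMagma ℕ) : monCoord (mon (ZMod 101) t) =
    if (monCode (t : RCMagma ℕ)).head = 0 then
      Finsupp.single (monCode (t : RCMagma ℕ)).index (1 : ZMod 101) else 0 := by
  simp [monCoord, mon]

/-- The span of the monomials that begin with `x_0`. -/
noncomputable def headZero : Submodule (ZMod 101) (FreeRC (ZMod 101) ℕ) :=
  Submodule.span _ {f | ∃ t : FreeMagma ℕ, (monCode (t : RCMagma ℕ)).head = 0 ∧ mon _ t = f}

theorem swap_swap_zero {c c' : ℕ} : Equiv.swap 0 c' (Equiv.swap 0 c 0) = 0 ↔ c = c' := by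
  rw [Equiv.swap_apply_left]
  constructor
  · intro h
    have := congrArg (Equiv.swap 0 c') h
    simpa using this
  · rintro rfl
    simp

/-- A transposition is an involution, which gives the case c = c'. For c ≠ c' the first letter 0 is
carried to a nonzero letter, where the coordinates vanish. -/
theorem monCoord_rename_rename (c c' : ℕ) {f : FreeRC (ZMod 101) ℕ} (hf : f ∈ headZero) :
    monCoord (rename _ (Equiv.swap 0 c') (rename _ (Equiv.swap 0 c) f)) =
      if c = c' then monCoord f else 0 := by
  split_ifs with h
  · subst h
    rw [rename_rename]
    simp only [Equiv.swap_apply_self, rename_id]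
  · have hle : headZero ≤ LinearMap.ker (monCoord ∘ₗ rename _ (Equiv.swap 0 c') ∘ₗ
        rename _ (Equiv.swap 0 c)) := by
      refine Submodule.span_le.2 ?_
      rintro _ ⟨t, ht, rfl⟩
      change monCoord (rename _ (Equiv.swap 0 c') (rename _ (Equiv.swap 0 c) (mon _ t))) = 0
      rw [rename_mon, rename_mon, monCoord_mon, head_monCode_graft, head_monCode_graft, ht,
        if_neg (mt swap_swap_zero.1 h)]
    exact hle hf

/-- The polynomial with a given list of terms. -/
noncomputable def ofTerms (p : List (FreeMagma ℕ × ℕ)) : FreeRC (ZMod 101) ℕ :=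
  (p.map fun e => (e.2 : ZMod 101) • mon (ZMod 101) e.1).sum

theorem map_ofTerms {V : Type*} [AddCommGroup V] [Module (ZMod 101) V]
    (φ : FreeRC (ZMod 101) ℕ →ₗ[ZMod 101] V) (p : List (FreeMagma ℕ × ℕ)) :
    φ (ofTerms p) = (p.map fun e => (e.2 : ZMod 101) • φ (mon (ZMod 101) e.1)).sum := by
  rw [ofTerms, map_list_sum, List.map_map]
  congr 2
  funext e
  exact map_smul _ _ _

theorem ofTerms_termsJ : ofTerms termsJ = J (ZMod 101) := by
  have h : ((100 : ℕ) : ZMod 101) = -1 := by decide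
  simp only [ofTerms, termsJ, List.map_cons, List.map_nil, List.sum_cons, List.sum_nil, h,
    FreeMagma.mul_eq, mon_mul, mon_of, J, Nat.cast_one, one_smul, neg_smul]
  abel

theorem ofTerms_termsK : ofTerms termsK = K (ZMod 101) := by
  have h : ((100 : ℕ) : ZMod 101) = -1 := by decide
  simp only [ofTerms, termsK, List.map_cons, List.map_nil, List.sum_cons, List.sum_nil, h,
    FreeMagma.mul_eq, mon_mul, mon_of, K, Nat.cast_one, one_smul, neg_smul]
  abel

theorem splitWord_eq_graft (n i : ℕ) (t : FreeMagma ℕ) :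
    splitWord n i t = graft (splitLetter i n) t := by
  induction t with
  | ih1 j =>
    change (Bool.rec (.of j) ((FreeMagma.of i).mul (.of n)) (Nat.beq j i) : FreeMagma ℕ) =
      splitLetter i n j
    by_cases hj : j = i
    · subst hj
      rw [Nat.beq_refl]
      simp [splitLetter, FreeMagma.mul_eq]
    · have : Nat.beq j i = false := by
        cases hb : Nat.beq j i with
        | false => rfl
        | true => exact absurd (Nat.eq_of_beq_eq_true hb) hj
      rw [this]
      simp [splitLetter, hj]
  | ih2 a b ha hb => exact congrArg₂ FreeMagma.mul ha hb

theorem liftWord_of_lt {n i : ℕ} (h : i < n) (t : FreeMagma ℕ) :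
    liftWord n i t = graft (splitLetter i n) t := by
  have hb : Nat.blt i n = true := Nat.ble_eq_true_of_le h
  rw [← splitWord_eq_graft, liftWord, hb]

theorem liftWord_of_ge {n i : ℕ} (h : n ≤ i) (t : FreeMagma ℕ) :
    liftWord n i t = t * FreeMagma.of n := by
  have hb : Nat.blt i n = false := by
    cases hb : Nat.blt i n with
    | false => rfl
    | true => exact absurd (Nat.le_of_ble_eq_true hb) (by omega)
  unfold liftWord
  rw [hb]
  rfl

theorem ofTerms_liftTerms_mem (n i : ℕ) (p : List (FreeMagma ℕ × ℕ)) :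
    ofTerms (liftTerms n i p) ∈ liftings n (ofTerms p) := by
  rcases lt_or_ge i n with h | h
  · refine Or.inl ⟨i, h, ?_⟩
    rw [← mon_splitLetter, map_ofTerms]
    simp only [ofTerms, liftTerms, List.map_map, Function.comp_def, liftWord_of_lt h, subst_mon]
  · refine Or.inr (Or.inl ?_)
    rw [← LinearMap.mulRight_apply (R := ZMod 101), map_ofTerms]
    simp only [ofTerms, liftTerms, List.map_map, Function.comp_def, liftWord_of_ge h,
      mon_mul, mon_of, LinearMap.mulRight_apply]

theorem ofTerms_mem_liftingsJK {e : List (FreeMagma ℕ × ℕ) × List ℕ} (he : e ∈ liftingRows) :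
    ofTerms e.1 ∈ liftingsJK (ZMod 101) 2 ∧ e.2.Perm (List.range 6) := by
  obtain ⟨⟨⟨p, i, j⟩, c⟩, hp, he⟩ := List.mem_flatMap.1 he
  obtain ⟨s, hs, rfl⟩ := List.mem_map.1 he
  have hJK : ∀ e ∈ liftingTable, e.1.1 = termsJ ∨ e.1.1 = termsK := by
    simp [liftingTable]
  have h0 : ofTerms p ∈ liftingsJK (ZMod 101) 0 := by
    rcases hJK _ hp with h | h <;> change p = _ at h <;> subst h
    · exact Or.inl ofTerms_termsJ
    · exact Or.inr ofTerms_termsK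
  exact ⟨⟨_, ⟨_, h0, ofTerms_liftTerms_mem 4 i p⟩, ofTerms_liftTerms_mem 5 j _⟩,
    perm_of_mem_arrangementsWith hs⟩

set_option maxRecDepth 100000 in
theorem head_liftingRows : (liftingRows.all fun e => e.1.all fun t =>
    Nat.beq (wordCode (listFun e.2) t.1).head 0) = true := by
  decide +kernel

/-- This links computation to algebra: the row consists of the coordinates of a renamed lifting, all
of whose terms begin with `x_0`. -/
theorem liftingRow_spec {e : List (FreeMagma ℕ × ℕ) × List ℕ} (he : e ∈ liftingRows) :
    ∃ r : SparseVec, r.toFinsupp ∈ (liftedIdentities (ZMod 101) 2 ⊓ headZero).map monCoord ∧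
      ∀ K, liftingRow e K = K r := by
  obtain ⟨r, hr, hK⟩ := SparseVec.ofEntries_spec
    (e.1.map fun t => ((wordCode (listFun e.2) t.1).index, t.2)) .nil
  refine ⟨r, ?_, fun K => hK K⟩
  have hhead : ∀ t ∈ e.1, (wordCode (listFun e.2) t.1).head = 0 := fun t ht =>
    Nat.eq_of_beq_eq_true (List.all_eq_true.1 (List.all_eq_true.1 head_liftingRows e he) t ht)
  obtain ⟨hlift, hperm⟩ := ofTerms_mem_liftingsJK he
  obtain ⟨σ, hσ, hσ'⟩ := exists_perm_eq_listFun hperm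
  have hren : rename (ZMod 101) σ (ofTerms e.1) = (e.1.map fun t => (t.2 : ZMod 101) •
      mon (ZMod 101) (graft (fun i => FreeMagma.of (listFun e.2 i)) t.1)).sum := by
    rw [map_ofTerms]
    simp only [rename_mon, hσ]
  refine ⟨rename (ZMod 101) σ (ofTerms e.1), ⟨?_, ?_⟩, ?_⟩
  · exact Submodule.subset_span ⟨σ, hσ', _, hlift, rfl⟩
  · rw [hren]
    refine list_sum_mem fun f hf => ?_
    obtain ⟨t, ht, rfl⟩ := List.mem_map.1 hf
    refine Submodule.smul_mem _ _ (Submodule.subset_span ⟨_, ?_, rfl⟩)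
    rw [monCode_graft, hhead t ht]
  · rw [hr, hren, map_list_sum, SparseVec.toFinsupp_nil, zero_add, List.map_map, List.map_map]
    refine congrArg List.sum (List.map_congr_left fun t ht => ?_)
    simp only [Function.comp_apply, map_smul, monCoord_mon, monCode_graft, hhead t ht, if_true,
      Finsupp.smul_single, smul_eq_mul, mul_one]

theorem finite_FRC (n : ℕ) : FiniteDimensional (ZMod 101) (FRC (ZMod 101) n) := by
  rw [FRC, MonoidAlgebra.supported_eq_span_single]
  exact FiniteDimensional.span_of_finite _ (Set.Finite.image _ (Set.finite_coe_iff.1 (inferInstanceAs (Finite (RCMon n)))))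

theorem swap_fix {n c i : ℕ} (hc : c < n) (hi : n ≤ i) : Equiv.swap 0 c i = i :=
  Equiv.swap_apply_of_ne_of_ne (by omega) (by omega)

theorem le_finrank_liftedIdentities :
    3690 ≤ Module.finrank (ZMod 101) (liftedIdentities (ZMod 101) 2) := by
  have := finite_FRC 6
  have hL : FiniteDimensional (ZMod 101) (liftedIdentities (ZMod 101) 2) :=
    Submodule.finiteDimensional_of_le (liftedIdentities_le_FRC 2)
  have hW : FiniteDimensional (ZMod 101)
      (liftedIdentities (ZMod 101) 2 ⊓ headZero : Submodule _ _) :=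
    Submodule.finiteDimensional_of_le inf_le_left
  have h1 := PivotTree.le_finrank_of_check (fun e he => liftingRow_spec he) check_liftingRows
  have h2 := six_mul_finrank_le monCoord (fun c => rename (ZMod 101) (Equiv.swap 0 (c : ℕ)))
    (liftedIdentities (ZMod 101) 2) (liftedIdentities (ZMod 101) 2 ⊓ headZero) inf_le_left
    (fun c f hf => rename_mem_liftedIdentities (fun i hi => swap_fix c.2 hi) hf)
    (fun c c' f hf => by simpa only [Fin.ext_iff] using monCoord_rename_rename c c' hf.2)
  omega

end Lifted

/-! ### The rank of the expansion map -/

section Expansion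

/-- The sum of a list of dialgebra monomials. -/
noncomputable def diSum (l : List (DiWord ℕ)) : FreeDi (ZMod 101) ℕ :=
  (l.map fun w => Finsupp.single w (1 : ZMod 101)).sum

theorem diSum_cons (w : DiWord ℕ) (l : List (DiWord ℕ)) :
    diSum (w :: l) = Finsupp.single w 1 + diSum l := List.sum_cons

theorem diSum_append (l m : List (DiWord ℕ)) : diSum (l ++ m) = diSum l + diSum m := by
  simp [diSum]

theorem qjMul_single (v w : DiWord ℕ) :
    qjMul (ZMod 101) (FreeDi (ZMod 101) ℕ) (Finsupp.single v 1) (Finsupp.single w 1) =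
      diSum [v.left w, w.right v] := by
  rw [qjMul_apply]
  change bilinExt _ _ _ _ + bilinExt _ _ _ _ = _
  rw [bilinExt_single, bilinExt_single]
  simp [diSum]

theorem qjMul_diSum (l m : List (DiWord ℕ)) :
    qjMul (ZMod 101) (FreeDi (ZMod 101) ℕ) (diSum l) (diSum m) =
      diSum (l.flatMap fun v => m.flatMap fun w => [v.left w, w.right v]) := by
  induction l with
  | nil => simp [diSum]
  | cons v l ih =>
    rw [diSum_cons, map_add, LinearMap.add_apply, ih, List.flatMap_cons, diSum_append]
    congr 1
    clear ih
    induction m with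
    | nil => simp [diSum]
    | cons w m ihm => rw [diSum_cons, map_add, ihm, List.flatMap_cons, diSum_append, qjMul_single]

theorem expandWord_mul (s t : FreeMagma ℕ) : expandWord (s * t) =
    (expandWord s).flatMap fun v => (expandWord t).flatMap fun w => [v.left w, w.right v] := rfl

theorem expand_mon (t : FreeMagma ℕ) : expand (ZMod 101) (mon _ t) = diSum (expandWord t) := by
  induction t with
  | ih1 i =>
    refine (eval_gen _ _ _ i).trans ?_
    simp [diSum, expandWord]
  | ih2 s t hs ht =>
    rw [mon_mul, expandWord_mul, ← qjMul_diSum, ← hs, ← ht]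
    exact eval_mul _ _ _ _ _

theorem toList_left (v w : DiWord ℕ) : (v.left w).toList = v.toList ++ w.toList := by
  simp [DiWord.left, DiWord.toList]

theorem toList_right (v w : DiWord ℕ) : (v.right w).toList = v.toList ++ w.toList := by
  simp [DiWord.right, DiWord.toList]

/-- Both terms of the quasi-Jordan product keep the center of the left factor. So the splitting by
first letter on one side matches the splitting by center on the other. -/
theorem mem_expandWord {t : FreeMagma ℕ} {w : DiWord ℕ} (hw : w ∈ expandWord t) :
    w.center = (monCode (t : RCMagma ℕ)).head ∧
      (w.toList : Multiset ℕ) = content (t : RCMagma ℕ) := by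
  induction t generalizing w with
  | ih1 i =>
    rw [List.mem_singleton.1 hw]
    exact ⟨rfl, rfl⟩
  | ih2 s t hs ht =>
    have hc : content ((s * t : FreeMagma ℕ) : RCMagma ℕ) = content (s : RCMagma ℕ) +
      content (t : RCMagma ℕ) := rfl
    rw [expandWord_mul, List.mem_flatMap] at hw
    obtain ⟨v, hv, hw⟩ := hw
    obtain ⟨u, hu, hw⟩ := List.mem_flatMap.1 hw
    rw [hc, ← (hs hv).2, ← (ht hu).2]
    rcases List.mem_pair.1 hw with rfl | rfl
    · exact ⟨(hs hv).1, by rw [toList_left, Multiset.coe_add]⟩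
    · exact ⟨(hs hv).1, by rw [toList_right, add_comm, Multiset.coe_add]⟩

/-- Renaming of the letters of a dialgebra monomial. -/
def diWordMap (σ : ℕ → ℕ) (w : DiWord ℕ) : DiWord ℕ :=
  ⟨w.pre.map σ, σ w.center, w.post.map σ⟩

theorem expandWord_graft (σ : ℕ → ℕ) (t : FreeMagma ℕ) :
    expandWord (graft (fun i => FreeMagma.of (σ i)) t) = (expandWord t).map (diWordMap σ) := by
  induction t with
  | ih1 i => rfl
  | ih2 s t hs ht =>
    have hg : graft (fun i => FreeMagma.of (σ i)) (s * t) =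
      graft (fun i => FreeMagma.of (σ i)) s * graft (fun i => FreeMagma.of (σ i)) t := rfl
    rw [hg, expandWord_mul, hs, ht, expandWord_mul]
    simp [List.map_flatMap, List.flatMap_map, diWordMap, DiWord.left, DiWord.right,
      DiWord.toList]

/-- Renaming of the variables in the free dialgebra. -/
noncomputable def diRename (σ : ℕ → ℕ) : FreeDi (ZMod 101) ℕ →ₗ[ZMod 101] FreeDi (ZMod 101) ℕ :=
  Finsupp.lmapDomain (ZMod 101) (ZMod 101) (diWordMap σ)

theorem diRename_single (σ : ℕ → ℕ) (w : DiWord ℕ) (r : ZMod 101) :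
    diRename σ (Finsupp.single w r) = Finsupp.single (diWordMap σ w) r := by
  simp [diRename, Finsupp.mapDomain_single]

theorem expand_rename (σ : ℕ → ℕ) (f : FreeRC (ZMod 101) ℕ) :
    expand _ (rename _ σ f) = diRename σ (expand _ f) := by
  induction f using freeRC_induction with
  | zero => simp
  | add f g hf hg => simp only [map_add, hf, hg]
  | smul r t =>
    simp only [map_smul, rename_mon, expand_mon, expandWord_graft, diSum, map_list_sum,
      List.map_map, Function.comp_def, diRename_single]

/-- Coordinates of the dialgebra monomials with center `x_0` in which `x_1` precedes the center. -/
noncomputable def diCoord : FreeDi (ZMod 101) ℕ →ₗ[ZMod 101] (ℕ →₀ ZMod 101) :=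
  Finsupp.linearCombination (ZMod 101) fun w => if w.center = 0 then
    Finsupp.single (diIndex w) (occurs 1 w.pre : ZMod 101) else 0

theorem diCoord_single (w : DiWord ℕ) : diCoord (Finsupp.single w 1) =
    if w.center = 0 then Finsupp.single (diIndex w) (occurs 1 w.pre : ZMod 101) else 0 := by
  simp [diCoord]

/-- The span of the dialgebra monomials with center `x_0`. -/
noncomputable def centerZero : Submodule (ZMod 101) (FreeDi (ZMod 101) ℕ) :=
  Submodule.span _ {f | ∃ w : DiWord ℕ, w.center = 0 ∧ Finsupp.single w 1 = f}

theorem diCoord_diRename_diRename (c c' : ℕ) {f : FreeDi (ZMod 101) ℕ} (hf : f ∈ centerZero) :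
    diCoord (diRename (Equiv.swap 0 c') (diRename (Equiv.swap 0 c) f)) =
      if c = c' then diCoord f else 0 := by
  have hle : centerZero ≤ LinearMap.ker (diCoord ∘ₗ diRename (Equiv.swap 0 c') ∘ₗ
      diRename (Equiv.swap 0 c) - if c = c' then diCoord else 0) := by
    refine Submodule.span_le.2 ?_
    rintro _ ⟨w, hw, rfl⟩
    rw [SetLike.mem_coe, LinearMap.mem_ker, LinearMap.sub_apply, sub_eq_zero]
    simp only [LinearMap.comp_apply, diRename_single]
    split_ifs with h
    · subst h
      simp [diWordMap, Function.comp_def]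
    · rw [diCoord_single, if_neg]
      · rfl
      · change ¬ Equiv.swap 0 c' (Equiv.swap 0 c w.center) = 0
        rw [hw, swap_swap_zero]
        exact h
  have := hle hf
  rw [LinearMap.mem_ker, LinearMap.sub_apply, sub_eq_zero] at this
  refine Eq.trans this ?_
  split_ifs <;> rfl

theorem extensions_spec : ∀ (p l : List ℕ) (t s : FreeMagma ℕ), s ∈ extensions p l t →
    (monCode (s : RCMagma ℕ)).head = (monCode (t : RCMagma ℕ)).head ∧
      content (s : RCMagma ℕ) = content (t : RCMagma ℕ) + (l : Multiset ℕ)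
  | [], l, t, s, h => by
    rw [extensions] at h
    split_ifs at h with hl
    · rw [List.mem_singleton.1 h, hl]
      simp
    · simp at h
  | 1 :: p, l, t, s, h => by
    rw [extensions, List.mem_flatMap] at h
    obtain ⟨i, hi, h⟩ := h
    obtain ⟨h1, h2⟩ := extensions_spec p _ _ _ h
    refine ⟨h1, h2.trans ?_⟩
    change content (t : RCMagma ℕ) + {i} + _ = _
    rw [add_assoc, ← Multiset.coe_erase, Multiset.singleton_add, Multiset.cons_erase (by simpa)]
  -- Every part other than 1 is treated by `extensions` as a product of two letters.
  | 0 :: p, l, t, s, h | (_ + 2) :: p, l, t, s, h => by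
    rw [extensions, List.mem_flatMap] at h
    · obtain ⟨i, hi, h⟩ := h
      obtain ⟨j, hj, h⟩ := List.mem_flatMap.1 h
      split_ifs at h
      · obtain ⟨h1, h2⟩ := extensions_spec p _ _ _ h
        refine ⟨h1, h2.trans ?_⟩
        change content (t : RCMagma ℕ) + ({i} + {j}) + _ = _
        rw [add_assoc, add_assoc, ← Multiset.coe_erase, Multiset.singleton_add j,
          Multiset.cons_erase (by simpa), ← Multiset.coe_erase, Multiset.singleton_add,
          Multiset.cons_erase (by simpa)]
      · simp at h
    · omega

theorem mem_expansionWords {t : FreeMagma ℕ} (ht : t ∈ expansionWords) :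
    (monCode (t : RCMagma ℕ)).head = 0 ∧ content (t : RCMagma ℕ) = Multiset.range 6 := by
  obtain ⟨p, -, h⟩ := List.mem_flatMap.1 ht
  obtain ⟨h1, h2⟩ := extensions_spec _ _ _ _ h
  exact ⟨h1, h2.trans (by decide)⟩

theorem expansionRow_spec {t : FreeMagma ℕ} (ht : t ∈ expansionWords) :
    ∃ r : SparseVec, r.toFinsupp ∈
      ((FRC (ZMod 101) 6).map (expand (ZMod 101)) ⊓ centerZero).map diCoord ∧
      ∀ K, expansionRow t K = K r := by
  obtain ⟨hhead, hcontent⟩ := mem_expansionWords ht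
  obtain ⟨r, hr, hK⟩ := SparseVec.ofEntries_spec
    ((expandWord t).map fun w => (diIndex w, occurs 1 w.pre)) .nil
  have hcenter : ∀ w ∈ expandWord t, w.center = 0 := fun w hw =>
    (mem_expandWord hw).1.trans hhead
  refine ⟨r, ⟨expand _ (mon _ t), ⟨⟨_, mon_mem_FRC hcontent, rfl⟩, ?_⟩, ?_⟩, fun K => hK K⟩
  · rw [expand_mon]
    refine list_sum_mem fun f hf => ?_
    obtain ⟨w, hw, rfl⟩ := List.mem_map.1 hf
    exact Submodule.subset_span ⟨w, hcenter w hw, rfl⟩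
  · rw [hr, expand_mon, diSum, map_list_sum, SparseVec.toFinsupp_nil, zero_add, List.map_map,
      List.map_map]
    refine congrArg List.sum (List.map_congr_left fun w hw => ?_)
    simp only [Function.comp_apply, diCoord_single, hcenter w hw, if_true]

theorem le_finrank_map_expand :
    1980 ≤ Module.finrank (ZMod 101) ((FRC (ZMod 101) 6).map (expand (ZMod 101))) := by
  have := finite_FRC 6
  have hW : FiniteDimensional (ZMod 101)
      ((FRC (ZMod 101) 6).map (expand (ZMod 101)) ⊓ centerZero : Submodule _ _) :=
    Submodule.finiteDimensional_of_le inf_le_left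
  have h1 := PivotTree.le_finrank_of_check (fun e he => expansionRow_spec he) check_expansionWords
  have h2 := six_mul_finrank_le diCoord (fun c => diRename (Equiv.swap 0 (c : ℕ)))
    ((FRC (ZMod 101) 6).map (expand (ZMod 101)))
    ((FRC (ZMod 101) 6).map (expand (ZMod 101)) ⊓ centerZero) inf_le_left
    (by
      rintro c _ ⟨f, hf, rfl⟩
      rw [← expand_rename]
      exact ⟨_, rename_mem_FRC (fun i hi => swap_fix c.2 hi) hf, rfl⟩)
    (fun c c' f hf => by simpa only [Fin.ext_iff] using diCoord_diRename_diRename c c' hf.2)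
  omega

end Expansion

/-! ### The numbers of monomials -/

section Counting

/-- The ways to split a list into two. -/
def splits : List ℕ → List (List ℕ × List ℕ)
  | [] => [([], [])]
  | x :: l => (splits l).flatMap fun e => [(x :: e.1, e.2), (e.1, x :: e.2)]

theorem exists_mem_splits {l : List ℕ} : ∀ {P Q : Multiset ℕ}, P + Q = l →
    ∃ e ∈ splits l, (e.1 : Multiset ℕ) = P ∧ (e.2 : Multiset ℕ) = Q := by
  induction l with
  | nil =>
    intro P Q h
    obtain ⟨rfl, rfl⟩ := add_eq_zero.1 h
    exact ⟨([], []), by simp [splits], rfl, rfl⟩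
  | cons x l ih =>
    intro P Q h
    rw [← Multiset.cons_coe] at h
    have hx : x ∈ P + Q := h ▸ Multiset.mem_cons_self x _
    rcases Multiset.mem_add.1 hx with hx | hx <;> obtain ⟨T, rfl⟩ := Multiset.exists_cons_of_mem hx
    · rw [Multiset.cons_add, Multiset.cons_inj_right] at h
      obtain ⟨e, he, rfl, rfl⟩ := ih h
      exact ⟨(x :: e.1, e.2), List.mem_flatMap.2 ⟨e, he, by simp⟩, rfl, rfl⟩
    · rw [Multiset.add_cons, Multiset.cons_inj_right] at h
      obtain ⟨e, he, rfl, rfl⟩ := ih h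
      exact ⟨(e.1, x :: e.2), List.mem_flatMap.2 ⟨e, he, by simp⟩, rfl, rfl⟩

/-- Representatives of the words with given letters, up to commutativity. -/
def commWords : ℕ → List ℕ → List (FreeMagma ℕ)
  | 0, _ => []
  | _ + 1, [] => []
  | n + 1, x :: l => (if l = [] then [.of x] else []) ++
      (splits l).flatMap fun e => (commWords n e.2).flatMap fun b =>
        (commWords n (x :: e.1)).map fun a => a.mul b

/-- Representatives of the words with given letters, up to right commutativity. -/
def rcWords : ℕ → List ℕ → List (FreeMagma ℕ)
  | 0, _ => []
  | n + 1, l => (if l.length = 1 then l.map .of else []) ++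
      (splits l).flatMap fun e => (rcWords n e.1).flatMap fun a =>
        (commWords n e.2).map fun b => a.mul b

/-- Words that become equal when they are multiplied on the left by any word. -/
def RightEquiv (b b' : FreeMagma ℕ) : Prop :=
  ∀ a : FreeMagma ℕ, conGen (RCRel ℕ) (a * b) (a * b')

theorem RightEquiv.swap (b c : FreeMagma ℕ) : RightEquiv (b * c) (c * b) :=
  fun a => ConGen.Rel.of _ _ (RCRel.rc a b c)

theorem RightEquiv.trans {b c d : FreeMagma ℕ} (h : RightEquiv b c) (h' : RightEquiv c d) :
    RightEquiv b d :=
  fun a => (conGen (RCRel ℕ)).trans (h a) (h' a)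

/-- The relation allows a replacement in the right factor directly. The left factor is swapped to
the right, replaced there, and swapped back. -/
theorem RightEquiv.mul {b b' c c' : FreeMagma ℕ} (hb : RightEquiv b b') (hc : RightEquiv c c') :
    RightEquiv (b * c) (b' * c') := by
  have key : ∀ d {e e' : FreeMagma ℕ}, RightEquiv e e' → RightEquiv (d * e) (d * e') :=
    fun d e e' h a => (conGen (RCRel ℕ)).mul ((conGen (RCRel ℕ)).refl a) (h d)
  exact (key b hc).trans ((RightEquiv.swap b c').trans ((key c' hb).trans (RightEquiv.swap c' b')))

theorem content_coe_mul (a b : FreeMagma ℕ) : content ((a * b : FreeMagma ℕ) : RCMagma ℕ) =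
    content (a : RCMagma ℕ) + content (b : RCMagma ℕ) := rfl

theorem card_content_pos (t : FreeMagma ℕ) : 0 < Multiset.card (content (t : RCMagma ℕ)) := by
  induction t with
  | ih1 i => exact Nat.one_pos
  | ih2 a b ha hb =>
    rw [content_coe_mul, Multiset.card_add]
    omega

/-- A swap brings the distinguished letter `x` into the left factor, so only splittings of the
remaining letters are listed. Both factors are nonempty, hence shorter than the word. -/
theorem exists_mem_commWords (n : ℕ) : ∀ {l : List ℕ} {t : FreeMagma ℕ}, l.length ≤ n →
    content (t : RCMagma ℕ) = l → ∃ s ∈ commWords n l, RightEquiv t s := by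
  induction n with
  | zero =>
    intro l t hl ht
    have := card_content_pos t
    rw [ht, Multiset.coe_card] at this
    omega
  | succ n ih =>
    intro l t hl ht
    cases t with
    | of i =>
      have hl' : l = [i] := Multiset.coe_eq_singleton.1 ht.symm
      subst hl'
      exact ⟨.of i, by simp [commWords], fun a => (conGen (RCRel ℕ)).refl _⟩
    | mul a b =>
      rw [FreeMagma.mul_eq] at ht ⊢
      rw [content_coe_mul] at ht
      cases l with
      | nil =>
        have := card_content_pos a
        rw [(add_eq_zero.1 ht).1] at this
        simp at this
      | cons x l =>
        have key : ∀ a b : FreeMagma ℕ, x ∈ content (a : RCMagma ℕ) →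
            content (a : RCMagma ℕ) + content (b : RCMagma ℕ) = (x :: l : List ℕ) →
            ∃ s ∈ commWords (n + 1) (x :: l), RightEquiv (a * b) s := by
          intro a b hx h
          obtain ⟨T, hT⟩ := Multiset.exists_cons_of_mem hx
          rw [hT, ← Multiset.cons_coe, Multiset.cons_add, Multiset.cons_inj_right] at h
          obtain ⟨⟨p, q⟩, he, hp, hq⟩ := exists_mem_splits h
          dsimp only at hp hq
          subst hp
          have hlen : p.length + q.length = l.length := by
            have := congrArg Multiset.card h
            rwa [← hq, Multiset.card_add, Multiset.coe_card, Multiset.coe_card,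
              Multiset.coe_card] at this
          have hpos : 0 < q.length := by
            have := card_content_pos b
            rwa [← hq, Multiset.coe_card] at this
          rw [List.length_cons] at hl
          obtain ⟨a', ha', haa⟩ := ih (l := x :: p) (t := a) (by rw [List.length_cons]; omega) hT
          obtain ⟨b', hb', hbb⟩ := ih (l := q) (t := b) (by omega) hq.symm
          refine ⟨a' * b', ?_, haa.mul hbb⟩
          rw [commWords]
          exact List.mem_append_right _ (List.mem_flatMap.2 ⟨_, he, List.mem_flatMap.2
            ⟨b', hb', List.mem_map.2 ⟨a', ha', rfl⟩⟩⟩)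
        have hx : x ∈ content (a : RCMagma ℕ) + content (b : RCMagma ℕ) := by
          rw [ht]
          simp
        rcases Multiset.mem_add.1 hx with hx | hx
        · exact key a b hx ht
        · obtain ⟨s, hs, h⟩ := key b a hx (by rw [add_comm, ht])
          exact ⟨s, hs, (RightEquiv.swap a b).trans h⟩

/-- The left factor may be changed only up to right commutativity, the right factor up to full
commutativity; hence the two kinds of representatives. -/
theorem exists_mem_rcWords (n : ℕ) : ∀ {l : List ℕ} {t : FreeMagma ℕ}, l.length ≤ n →
    content (t : RCMagma ℕ) = l → ∃ s ∈ rcWords n l, conGen (RCRel ℕ) t s := by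
  induction n with
  | zero =>
    intro l t hl ht
    have := card_content_pos t
    rw [ht, Multiset.coe_card] at this
    omega
  | succ n ih =>
    intro l t hl ht
    cases t with
    | of i =>
      have hl' : l = [i] := Multiset.coe_eq_singleton.1 ht.symm
      subst hl'
      exact ⟨.of i, by simp [rcWords], (conGen (RCRel ℕ)).refl _⟩
    | mul a b =>
      rw [FreeMagma.mul_eq] at ht ⊢
      rw [content_coe_mul] at ht
      obtain ⟨⟨p, q⟩, he, hp, hq⟩ := exists_mem_splits ht
      dsimp only at hp hq
      have hlen : p.length + q.length = l.length := by
        have := congrArg Multiset.card ht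
        rwa [← hp, ← hq, Multiset.card_add, Multiset.coe_card, Multiset.coe_card,
          Multiset.coe_card] at this
      have hppos : 0 < p.length := by
        have := card_content_pos a
        rwa [← hp, Multiset.coe_card] at this
      have hqpos : 0 < q.length := by
        have := card_content_pos b
        rwa [← hq, Multiset.coe_card] at this
      obtain ⟨a', ha', haa⟩ := ih (l := p) (t := a) (by omega) hp.symm
      obtain ⟨b', hb', hbb⟩ := exists_mem_commWords n (l := q) (t := b) (by omega) hq.symm
      refine ⟨a' * b', ?_, ?_⟩
      · rw [rcWords]
        exact List.mem_append_right _ (List.mem_flatMap.2 ⟨_, he, List.mem_flatMap.2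
          ⟨a', ha', List.mem_map.2 ⟨b', hb', rfl⟩⟩⟩)
      · exact (conGen (RCRel ℕ)).trans (hbb a)
          ((conGen (RCRel ℕ)).mul haa ((conGen (RCRel ℕ)).refl b'))

set_option maxRecDepth 100000 in
theorem length_rcWords : (rcWords 6 (List.range 6)).length = 5670 := by
  decide +kernel

/-- The representatives are not shown to be inequivalent; the reverse inequality comes from rank
plus nullity in `mainTheorem6`. -/
theorem card_RCMon_le : Nat.card (RCMon 6) ≤ 5670 := by
  classical
  let q : FreeMagma ℕ → RCMagma ℕ := fun t => t
  let S : Finset (RCMagma ℕ) := ((rcWords 6 (List.range 6)).map q).toFinset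
  have hmem : ∀ w : RCMon 6, w.1 ∈ S := by
    rintro ⟨w, hw⟩
    induction w using Con.induction_on with
    | H t =>
      obtain ⟨s, hs, h⟩ := exists_mem_rcWords 6 (l := List.range 6) (by simp)
        (hw : content (t : RCMagma ℕ) = Multiset.range 6)
      exact List.mem_toFinset.2 (List.mem_map.2 ⟨s, hs, ((Con.eq _).2 h).symm⟩)
  have hinj : Function.Injective fun w : RCMon 6 => (⟨w.1, hmem w⟩ : S) :=
    fun v w h => Subtype.ext (congrArg (fun x : S => (x : RCMagma ℕ)) h)
  calc Nat.card (RCMon 6) ≤ Nat.card S := Nat.card_le_card_of_injective _ hinj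
    _ = S.card := by simp
    _ ≤ _ := List.toFinset_card_le _
    _ = 5670 := by rw [List.length_map, length_rcWords]

/-- A multilinear dialgebra monomial is given by its word and the position of its center. -/
def diMonEquiv (n : ℕ) : DiMon n ≃ {l : List ℕ // (l : Multiset ℕ) = Multiset.range n} × Fin n where
  toFun w := (⟨w.1.toList, w.2⟩, ⟨w.1.pre.length, by
    have := congrArg Multiset.card w.2
    simp only [DiWord.toList, Multiset.coe_card, List.length_append, List.length_cons,
      Multiset.card_range] at this
    omega⟩)
  invFun e :=
    have h : e.2.1 < e.1.1.length := by
      have := congrArg Multiset.card e.1.2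
      rw [Multiset.coe_card, Multiset.card_range] at this
      exact e.2.2.trans_eq this.symm
    ⟨⟨e.1.1.take e.2.1, e.1.1[e.2.1], e.1.1.drop (e.2.1 + 1)⟩, by
      rw [DiWord.toList, List.getElem_cons_drop, List.take_append_drop]
      exact e.1.2⟩
  left_inv w := by
    apply Subtype.ext
    ext1 <;> simp [DiWord.toList]
  right_inv e := by
    have h : e.2.1 < e.1.1.length := by
      have := congrArg Multiset.card e.1.2
      rw [Multiset.coe_card, Multiset.card_range] at this
      exact e.2.2.trans_eq this.symm
    refine Prod.ext (Subtype.ext ?_) (Fin.ext ?_)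
    · simp [DiWord.toList]
    · simp [h.le]

theorem card_DiMon (n : ℕ) : Nat.card (DiMon n) = n.factorial * n := by
  have h : Nat.card {l : List ℕ // (l : Multiset ℕ) = Multiset.range n} = n.factorial := by
    have hiff : ∀ l : List ℕ, (l : Multiset ℕ) = Multiset.range n ↔
        l ∈ (List.range n).permutations.toFinset := fun l => by
      rw [List.mem_toFinset, List.mem_permutations, ← Multiset.coe_eq_coe]
      rfl
    rw [Nat.card_congr (Equiv.subtypeEquivRight hiff), Nat.card_eq_fintype_card, Fintype.card_coe,
      List.toFinset_card_of_nodup (List.nodup_permutations _ List.nodup_range),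
      List.length_permutations, List.length_range]
  rw [Nat.card_congr (diMonEquiv n), Nat.card_prod, h, Nat.card_fin]

end Counting

/-! ### The expansion matrix -/

section Matrix

theorem finrank_FRC (n : ℕ) :
    Module.finrank (ZMod 101) (FRC (ZMod 101) n) = Nat.card (RCMon n) := by
  have : Finite ↥{w : RCMagma ℕ | content w = Multiset.range n} :=
    inferInstanceAs (Finite (RCMon n))
  have := Fintype.ofFinite ↥{w : RCMagma ℕ | content w = Multiset.range n}
  rw [FRC, (MonoidAlgebra.supportedEquivFinsupp _).finrank_eq, Module.finrank_finsupp_self,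
    ← Nat.card_eq_fintype_card]
  rfl

theorem finrank_map_add_finrank_inf_ker {k V W : Type*} [Field k] [AddCommGroup V] [Module k V]
    [AddCommGroup W] [Module k W] (φ : V →ₗ[k] W) (L : Submodule k V) [FiniteDimensional k L] :
    Module.finrank k (L.map φ) + Module.finrank k (L ⊓ LinearMap.ker φ : Submodule k V) =
      Module.finrank k L := by
  rw [← LinearMap.finrank_range_add_finrank_ker (φ.domRestrict L), LinearMap.range_domRestrict,
    LinearMap.ker_domRestrict, ← Submodule.map_comap_subtype,
    Submodule.finrank_map_subtype_eq]

/-- The multilinear polynomial with given coefficients. -/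
noncomputable def ofCoeffs (n : ℕ) : (RCMon n → ZMod 101) →ₗ[ZMod 101] FreeRC (ZMod 101) ℕ :=
  Fintype.linearCombination (ZMod 101) fun j => MonoidAlgebra.single j.1 1

theorem ofCoeffs_injective (n : ℕ) : Function.Injective (ofCoeffs n) := by
  have h : LinearIndependent (ZMod 101)
      fun j : RCMon n => (MonoidAlgebra.single j.1 1 : FreeRC (ZMod 101) ℕ) :=
    ((Finsupp.linearIndependent_single_one (ZMod 101) (RCMagma ℕ)).comp _
      Subtype.val_injective).map' (MonoidAlgebra.coeffLinearEquiv (ZMod 101)).symm.toLinearMap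
      (LinearEquiv.ker _)
  exact linearIndependent_iff_injective_fintypeLinearCombination.1 h

theorem range_ofCoeffs (n : ℕ) : LinearMap.range (ofCoeffs n) = FRC (ZMod 101) n := by
  rw [ofCoeffs, Fintype.range_linearCombination, FRC, MonoidAlgebra.supported_eq_span_single]
  congr 1
  ext f
  constructor
  · rintro ⟨j, rfl⟩
    exact ⟨j.1, j.2, rfl⟩
  · rintro ⟨w, hw, rfl⟩
    exact ⟨⟨w, hw⟩, rfl⟩

theorem expansionMatrix_mulVec (n : ℕ) (v : RCMon n → ZMod 101) (i : DiMon n) :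
    (expansionMatrix (ZMod 101) n).mulVec v i = expand (ZMod 101) (ofCoeffs n v) i.1 := by
  simp only [ofCoeffs, Fintype.linearCombination_apply, map_sum, map_smul, Finsupp.coe_finsetSum,
    Finset.sum_apply, Finsupp.smul_apply, Matrix.mulVec, dotProduct, expansionMatrix, smul_eq_mul]
  exact Finset.sum_congr rfl fun j _ => mul_comm _ _

/-- Expansion preserves the multiset of letters. So the rows of the matrix, which see only
multilinear words, detect the whole kernel. -/
theorem expand_apply_eq_zero {n : ℕ} {f : FreeRC (ZMod 101) ℕ} (hf : f ∈ FRC (ZMod 101) n)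
    {w : DiWord ℕ} (hw : (w.toList : Multiset ℕ) ≠ Multiset.range n) :
    expand (ZMod 101) f w = 0 := by
  classical
  refine map_FRC_le (expand (ZMod 101)) (LinearMap.ker (Finsupp.lapply w)) (fun t ht => ?_) hf
  rw [expand_mon, LinearMap.mem_ker, diSum, map_list_sum]
  refine List.sum_eq_zero fun r hr => ?_
  simp only [List.map_map, List.mem_map] at hr
  obtain ⟨v, hv, rfl⟩ := hr
  refine Finsupp.single_eq_of_ne fun h => hw ?_
  rw [h, (mem_expandWord hv).2, ht]

theorem ker_expansionMatrix (n : ℕ) : LinearMap.ker (expansionMatrix (ZMod 101) n).mulVecLin =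
    (FRC (ZMod 101) n ⊓ LinearMap.ker (expand (ZMod 101))).comap (ofCoeffs n) := by
  ext v
  have hv : ofCoeffs n v ∈ FRC (ZMod 101) n := range_ofCoeffs n ▸ LinearMap.mem_range_self _ v
  rw [Submodule.mem_comap, Submodule.mem_inf, and_iff_right hv, LinearMap.mem_ker,
    LinearMap.mem_ker, Matrix.mulVecLin_apply]
  constructor
  · intro h
    ext w
    by_cases hw : (w.toList : Multiset ℕ) = Multiset.range n
    · exact (expansionMatrix_mulVec n v ⟨w, hw⟩).symm.trans (congrFun h ⟨w, hw⟩)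
    · exact expand_apply_eq_zero hv hw
  · intro h
    funext i
    rw [expansionMatrix_mulVec, h]
    rfl

theorem finrank_ker_expansionMatrix (n : ℕ) :
    Module.finrank (ZMod 101) (LinearMap.ker (expansionMatrix (ZMod 101) n).mulVecLin) =
      Module.finrank (ZMod 101)
        (FRC (ZMod 101) n ⊓ LinearMap.ker (expand (ZMod 101)) : Submodule _ _) := by
  rw [ker_expansionMatrix, (Submodule.equivMapOfInjective _ (ofCoeffs_injective n) _).finrank_eq,
    Submodule.map_comap_eq, range_ofCoeffs, ← inf_assoc, inf_idem]

end Matrix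

/-! ### The squeeze in degree 6 -/

theorem liftedIdentities_le_consequences (k : ℕ) :
    liftedIdentities (ZMod 101) k ≤ consequences (ZMod 101) 5 := by
  have h : ∀ f : FreeRC (ZMod 101) ℕ, IsIdentity f → f ∈ FRC (ZMod 101) 4 →
      f ∈ consequences (ZMod 101) 5 := fun f hf hf4 =>
    subset_tIdeal {f | IsIdentity f ∧ ∃ k ≤ 5, f ∈ FRC (ZMod 101) k} ⟨hf, 4, by norm_num, hf4⟩
  exact liftedIdentities_le_tIdeal (h _ isIdentity_J J_mem_FRC) (h _ isIdentity_K K_mem_FRC) k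

end QuasiJordan

theorem mainTheorem6 :
    (∀ f ∈ QuasiJordan.FRC (ZMod 101) 6, QuasiJordan.IsIdentity f →
      f ∈ QuasiJordan.consequences (ZMod 101) 5) ∧
    Module.finrank (ZMod 101)
      ↥(QuasiJordan.consequences (ZMod 101) 5 ⊓ QuasiJordan.FRC (ZMod 101) 6) = 3690 ∧
    Module.finrank (ZMod 101) ↥(QuasiJordan.liftedIdentities (ZMod 101) 2) = 3690 ∧
    Nat.card (QuasiJordan.DiMon 6) = 4320 ∧
    Nat.card (QuasiJordan.RCMon 6) = 5670 ∧
    Module.finrank (ZMod 101)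
      ↥(LinearMap.ker (QuasiJordan.expansionMatrix (ZMod 101) 6).mulVecLin) = 3690 := by
  open QuasiJordan in
  have := fact_prime_101
  have := finite_FRC 6
  have hrank := finrank_map_add_finrank_inf_ker (expand (ZMod 101)) (FRC (ZMod 101) 6)
  have hL := le_finrank_liftedIdentities
  have hE := le_finrank_map_expand
  have hN := card_RCMon_le
  rw [finrank_FRC] at hrank
  have hcons : consequences (ZMod 101) 5 ⊓ FRC (ZMod 101) 6 ≤
      FRC (ZMod 101) 6 ⊓ LinearMap.ker (expand (ZMod 101)) := fun f hf =>
    ⟨hf.2, identities_le_ker_expand (consequences_le_identities 5 hf.1)⟩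
  have hlift : liftedIdentities (ZMod 101) 2 ≤ consequences (ZMod 101) 5 ⊓ FRC (ZMod 101) 6 :=
    le_inf (liftedIdentities_le_consequences 2) (liftedIdentities_le_FRC 2)
  have hfin : FiniteDimensional (ZMod 101)
      (FRC (ZMod 101) 6 ⊓ LinearMap.ker (expand (ZMod 101)) : Submodule _ _) :=
    Submodule.finiteDimensional_of_le inf_le_left
  have hle := Submodule.finrank_mono (hlift.trans hcons)
  have heq : liftedIdentities (ZMod 101) 2 =
      FRC (ZMod 101) 6 ⊓ LinearMap.ker (expand (ZMod 101)) :=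
    -- The nullity is at most 5670 − 1980 = 3690, which the lifted identities already attain.
    Submodule.eq_of_le_of_finrank_le (hlift.trans hcons) (by omega)
  have heq' : consequences (ZMod 101) 5 ⊓ FRC (ZMod 101) 6 =
      FRC (ZMod 101) 6 ⊓ LinearMap.ker (expand (ZMod 101)) :=
    le_antisymm hcons (heq ▸ hlift)
  refine ⟨fun f hf hid => ?_, ?_, ?_, ?_, ?_, ?_⟩
  · exact (heq'.ge ⟨hf, identities_le_ker_expand hid⟩).1
  · rw [heq']
    omega
  · rw [heq]
    omega
  · rw [card_DiMon]
    rfl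
  -- The number of monomials is rank plus nullity, hence at least 1980 + 3690.
  · omega
  · rw [finrank_ker_expansionMatrix]
    omega
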